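/- Let $\Sigma=\{0,1\}$, let $\Sigma'=\bigcup_{l\ge 0}\Sigma^l$ be the set of finite bit strings, and fix a response length $T$. Let $f\mapsto r_f$ assign to each next-token predictor $f:\Sigma'\to\Sigma$ a binary reward $r_f:\Sigma'\times\Sigma^T\to\{0,1\}$ (for instance the end-token or the 0-1 reward). Let $\mathcal F$ be a nonempty class of predictors whose reward class $\mathcal R_{\mathcal F}=\{r_f: f\in\mathcal F\}$ has finite VC dimension, let $f_*$ be any target predictor (not necessarily in $\mathcal F$), let $P_x$ be a probability distribution on $\Sigma'$, and let $\pi_0(\cdot|x)$, $x\in\Sigma'$, be probability distributions on $\Sigma^T$. Suppose that $0<\alpha<1$ and that the coverage $P_0(x,r_{f_*})=\mathbb P_{\mathbf y\sim\pi_0(\cdot|x)}(r_{f_*}(x,\mathbf y)=1)$ is at least $\alpha$ for every $x$. For $n\ge 1$ and $\delta\in(0,1)$ put $$\kappa=\inf_{r\in\mathcal R_{\mathcal F}}\mathbb P_{x\sim P_x,\ \mathbf y\sim\pi_0(\cdot|x)}\big(r(x,\mathbf y)\ne r_{f_*}(x,\mathbf y)\big),\qquad H=\sqrt{\frac{\mathrm{VC}(\mathcal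 R_{\mathcal F})+\log(1/\delta)}{n}},$$ and let $$N=\left\lceil\log_{1-\alpha}\Big(\frac{-\kappa-H}{\log(1-\alpha)}\Big)\right\rceil,$$ assumed to be at least $1$. Let the training data $\mathcal D_n=\{((x_i,\mathbf y_i),r_{f_*}(x_i,\mathbf y_i))\}_{i=1}^n$ be i.i.d. with $x_i\sim P_x$ and $\mathbf y_i\sim\pi_0(\cdot|x_i)$. For a reward model $\hat r$, let $\hat\pi_{\mathrm{BoN}}(\cdot|x)$ be the Best-of-$N$ policy: draw $N$ independent candidates from $\pi_0(\cdot|x)$ and return a draw that maximizes $\hat r(x,\cdot)$ among them, ties being broken uniformly at random among the draws. Then, with probability at least $1-\delta$ over $\mathcal D_n$, for every minimizer $\hat r\in\arg\min_{r\in\mathcal R_{\mathcal F}}\sum_{i=1}^n\mathbf 1\{r(x_i,\mathbf y_i)\ne r_{f_*}(x_i,\mathbf y_i)\}$, $$\mathbb E_{x\sim P_x}\,\mathbb E_{\mathbf y\sim\hat\pi_{\mathrm{BoN}}(\cdot|x)}\,r_{f_*}(x,\mathbf y)\ \ge\ 1-(\kappa+H)\left(\log_{1-\alpha}\Big(\frac{-\kappa-H}{\log(1-\alpha)}\Big)-\frac1{\log(1-\alpha)}\right).$$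 -/

import Mathlib

open scoped ENNReal

noncomputable section

namespace BestOfN

/-- `Σ'`: the finite bit strings (prompts). -/
abbrev Prompt : Type := List Bool

/-- `Σ^T`: the bit strings of length `T` (responses). -/
abbrev Response (T : ℕ) : Type := Fin T → Bool

/-- Binary rewards `Σ' × Σ^T → {0,1}`. -/
abbrev Reward (T : ℕ) : Type := Prompt × Response T → Bool

/-- Next token predictors `Σ' → Σ`. -/
abbrev Predictor : Type := Prompt → Bool

/-! ### Discrete probability -/

/-- The law of `n` independent draws from `p`. -/
def iid {α : Type*} (p : PMF α) : (n : ℕ) → PMF (Fin n → α)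
  | 0 => PMF.pure Fin.elim0
  | n + 1 => p.bind fun a => (iid p n).map fun v => Fin.cons a v

/-- `iid p n` is the `n`-fold product measure of `p`. -/
theorem iid_apply {α : Type*} (p : PMF α) (n : ℕ) (v : Fin n → α) :
    iid p n v = ∏ i, p (v i) := by
  induction n with
  | zero =>
    have : v = Fin.elim0 := Subsingleton.elim _ _
    simp [iid, this]
  | succ n ih =>
    classical
    rw [iid, PMF.bind_apply, tsum_eq_single (v 0)]
    · rw [PMF.map_apply, tsum_eq_single (Fin.tail v)]
      · rw [if_pos (Fin.cons_self_tail v).symm, ih, Fin.prod_univ_succ]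
        rfl
      · intro w hw
        rw [if_neg]
        intro h
        exact hw (by rw [h, Fin.tail_cons])
    · intro a ha
      rw [PMF.map_apply, ENNReal.tsum_eq_zero.2, mul_zero]
      intro w
      rw [if_neg]
      intro h
      exact ha (by rw [h, Fin.cons_zero])

/-- The expectation of a bounded function under a discrete law. -/
def expect {α : Type*} (p : PMF α) (f : α → ℝ) : ℝ := ∑' a, (p a).toReal * f a

/-- The indicator of a proposition. -/
def ind (P : Prop) : ℝ := open Classical in if P then 1 else 0

/-! ### VC dimension -/

/-- `H` realizes every binary labelling of the finite set `s`. -/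
def Shattered {X : Type*} (H : Set (X → Bool)) (s : Finset X) : Prop :=
  ∀ g : X → Bool, ∃ h ∈ H, ∀ x ∈ s, h x = g x

/-- The VC dimension: the supremum of the sizes of the shattered sets. -/
def vcDim {X : Type*} (H : Set (X → Bool)) : ℕ∞ :=
  ⨆ s ∈ {s : Finset X | Shattered H s}, (s.card : ℕ∞)

/-! ### Training the reward model -/

variable {T : ℕ}

/-- The class `R_F` of the rewards `r_f` induced by `f ∈ F`. -/
def rewardClass (r : Predictor → Reward T) (F : Set Predictor) : Set (Reward T) := r '' F

/-- The law `P_x × π₀(y|x)` of a prompt together with a base response. -/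
def promptResponse (PX : PMF Prompt) (π₀ : Prompt → PMF (Response T)) :
    PMF (Prompt × Response T) :=
  PX.bind fun x => (π₀ x).map fun y => (x, y)

/-- The law `P_x × π₀(y|x) × r_*(x,y)` of one training example. -/
def exampleLaw (PX : PMF Prompt) (π₀ : Prompt → PMF (Response T)) (rstar : Reward T) :
    PMF ((Prompt × Response T) × Bool) :=
  (promptResponse PX π₀).map fun z => (z, rstar z)

/-- The number of training examples that `ρ` misclassifies. -/
def trainError {n : ℕ} (D : Fin n → (Prompt × Response T) × Bool) (ρ : Reward T) : ℕ :=
  (Finset.univ.filter fun i => ρ (D i).1 ≠ (D i).2).card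

/-- `ρ` minimizes the training error over the class `R`. -/
def IsERM {n : ℕ} (R : Set (Reward T)) (D : Fin n → (Prompt × Response T) × Bool)
    (ρ : Reward T) : Prop :=
  ρ ∈ R ∧ ∀ ρ' ∈ R, trainError D ρ ≤ trainError D ρ'

/-- The probability that `ρ` misclassifies a base response. -/
def classError (PX : PMF Prompt) (π₀ : Prompt → PMF (Response T)) (rstar ρ : Reward T) : ℝ :=
  expect (promptResponse PX π₀) fun z => ind (rstar z ≠ ρ z)

/-- `κ`: the best achievable classification error in the class `R`. -/
def kappa (PX : PMF Prompt) (π₀ : Prompt → PMF (Response T)) (rstar : Reward T)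
    (R : Set (Reward T)) : ℝ :=
  sInf (classError PX π₀ rstar '' R)

/-- `H(n, R, δ) = √((VC(R) + log (1/δ)) / n)`, used for classes of finite VC dimension. -/
def rate (n : ℕ) (R : Set (Reward T)) (δ : ℝ) : ℝ :=
  √((((vcDim R).toNat : ℝ) + Real.log (1 / δ)) / n)

/-- The coverage `P₀(x, r)`: the probability that a base response to `x` has reward one. -/
def coverage (π₀ : Prompt → PMF (Response T)) (rstar : Reward T) (x : Prompt) : ℝ :=
  expect (π₀ x) fun y => ind (rstar (x, y) = true)

/-! ### Best-of-N -/

/-- The indices of the candidates that score highest under `ρ`. -/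
def best {N : ℕ} (ρ : Reward T) (x : Prompt) (ys : Fin N → Response T) : Finset (Fin N) :=
  Finset.univ.filter fun j => ∀ k, ρ (x, ys k) ≤ ρ (x, ys j)

theorem best_nonempty {N : ℕ} [NeZero N] (ρ : Reward T) (x : Prompt)
    (ys : Fin N → Response T) : (best ρ x ys).Nonempty := by
  obtain ⟨j, _, hj⟩ := Finset.exists_max_image (Finset.univ : Finset (Fin N))
    (fun j => ρ (x, ys j)) Finset.univ_nonempty
  exact ⟨j, by simpa [best] using fun k => hj k (Finset.mem_univ k)⟩

/-- The BoN policy: draw `N` independent candidates from `π₀(·|x)` and return one of the draws that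
score highest under `ρ`, with ties broken uniformly at random. -/
def bonPolicy (π₀ : Prompt → PMF (Response T)) (ρ : Reward T) (N : ℕ) [NeZero N]
    (x : Prompt) : PMF (Response T) :=
  (iid (π₀ x) N).bind fun ys =>
    (PMF.uniformOfFinset (best ρ x ys) (best_nonempty ρ x ys)).map ys

/-- The expected reward `E_{x ∼ P_x} E_{y ∼ π(·|x)} r(x, y)` of a policy. -/
def expectedReward (PX : PMF Prompt) (π : Prompt → PMF (Response T)) (rstar : Reward T) : ℝ :=
  expect PX fun x => expect (π x) fun y => ind (rstar (x, y) = true)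

end BestOfN

end

/-! Put `x = 1 - α`, `c = -log x`, `s = (κ + H) / c` and `N = M + 1`. The ceiling says `x ^ (M + 1)
≤ s ≤ x ^ M`, and the claimed bound is `1 - s * (1 - log s)`. If `M = 0`, a single base draw fails
with probability at most `x ≤ s`, which is enough. If `M ≥ 1`, then `t = κ + H = c * s ≤ -x log x ≤
1/e`, and two independent estimates meet.

Statistics (`tsum_erm_error_le`): with probability at least `1 - δ` every empirical risk minimizer
has error at most `t + 25/4 * t ^ 2`. Since `H` carries no universal constant, crude symmetrization
does not suffice. Each training point is hidden among eight ghost points. On the event that a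
function of large error trains at least as well as a near-optimal comparison function, a tilted
exponential moment is large. Averaging over the hidden positions removes the labels of that function
(`sum_exp_tilt_le`), and Sauer-Shelah on `9 * n` points pays for the union over restrictions. The
factor `9` costs `2 * log 3` in the exponent, which the variance-sensitive deviation term absorbs.

Best-of-N (`exists_affine_bound`): at a fixed prompt the failure probability is an explicit function
of the masses `a` (bad, high score), `u` (bad, low score) and `b` (good, low score). Convexity
dominates it by an affine function `A + B * (a + b)` of the misjudged mass. Being affine, the bound
averages over prompts, and `a + b` averages to the classification error. What remains is the scalar
inequality `A + B * (t + 25/4 * t ^ 2) ≤ s * (1 - log s)`, with worst case `s = x ^ M` for the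
generic choice of `A` and `B`. -/

/-! ### Numerical inequalities: the deviation exponent dominates the entropy term. -/

theorem exp_neg_le_of_pow (a b : ℕ) (hb : b ≠ 0) (c : ℝ) (hc : 0 < c)
    (h : (1 / c) ^ b ≤ (2.7182818283 : ℝ) ^ a) : Real.exp (-(a / b : ℝ)) ≤ c := by
  have hb' : (0 : ℝ) < b := by positivity
  have h1 : (1 / c) ^ b ≤ Real.exp (a / b : ℝ) ^ b := by
    rw [← Real.exp_nat_mul, mul_div_cancel₀ _ hb'.ne']
    calc (1 / c) ^ b ≤ (2.7182818283 : ℝ) ^ a := h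
      _ ≤ Real.exp 1 ^ a := by
        gcongr
        exact Real.exp_one_gt_d9.le
      _ = Real.exp a := by rw [← Real.exp_nat_mul, mul_one]
  have h2 : 1 / c ≤ Real.exp (a / b : ℝ) := le_of_pow_le_pow_left₀ hb (by positivity) h1
  rw [Real.exp_neg]
  exact inv_le_of_inv_le₀ hc (by simpa using h2)

theorem log_three_le : Real.log 3 ≤ 1.1 := by
  have h := exp_neg_le_of_pow 11 10 (by norm_num) (1 / 3) (by norm_num) (by norm_num)
  rw [Real.log_le_iff_le_exp (by norm_num)]
  rw [Real.exp_neg, one_div] at h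
  have := (inv_le_inv₀ (Real.exp_pos _) (by norm_num)).1 h
  norm_num at this ⊢
  exact this

/-- The function `-t log t` is concave; this is its tangent at `exp (-l)`, with the intercept
rounded up to `c`. -/
theorem neg_log_le_tangent {t : ℝ} (ht : 0 < t) (l c : ℝ) (hc : Real.exp (-l) ≤ c) :
    t * -Real.log t ≤ (l - 1) * t + c := by
  have h := Real.add_one_le_exp (-l - Real.log t)
  have h2 : Real.exp (-l - Real.log t) * t = Real.exp (-l) := by
    rw [Real.exp_sub, Real.exp_log ht, div_mul_cancel₀ _ ht.ne']
  nlinarith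

/-- This is `y ≤ sinh y` at `y = -log r`. -/
theorem neg_log_le_half {r : ℝ} (hr : 0 < r) (hr1 : r ≤ 1) :
    -Real.log r ≤ (1 - r ^ 2) / (2 * r) := by
  have h := Real.self_le_sinh_iff.2 (neg_nonneg.2 (Real.log_nonpos hr.le hr1))
  rw [Real.sinh_eq, neg_neg, Real.exp_neg, Real.exp_log hr] at h
  refine h.trans (le_of_eq ?_)
  field_simp

/-- A polynomial of bidegree `(2, 4)` whose Bernstein coefficients are nonnegative. -/
theorem bernstein_terms_nonneg {t t₀ t₁ r r₀ r₁ : ℝ} (h1 : t₀ ≤ t) (h2 : t ≤ t₁) (h3 : r₀ ≤ r)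
    (h4 : r ≤ r₁) (i j k l : ℕ) :
    0 ≤ (t - t₀) ^ i * (t₁ - t) ^ j * ((r - r₀) ^ k * (r₁ - r) ^ l) := by
  have := sub_nonneg.2 h1
  have := sub_nonneg.2 h2
  have := sub_nonneg.2 h3
  have := sub_nonneg.2 h4
  positivity

theorem quartic_bound_small {t r : ℝ} (h1 : 0 ≤ t) (h2 : t ≤ 0.08) (h3 : 0 ≤ r) (h4 : r ≤ 1) :
    (5.44 + 9 * t - 4 * r) * ((7 * t + 0.1101) * r ^ 2 + t * (r * (1 - r ^ 2))) ≤
      8 / 9 * (r + 25 / 4 * t) ^ 2 := by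
  -- On each half of the `r`-interval the difference of the two sides is certified by the fifteen
  -- Bernstein products of bidegree `(2, 4)`.
  rcases le_total r (1 / 2) with h | h
  · have := bernstein_terms_nonneg h1 h2 h3 h
    linarith [this 2 0 0 4, this 2 0 1 3, this 2 0 2 2, this 2 0 3 1, this 2 0 4 0,
      this 1 1 0 4, this 1 1 1 3, this 1 1 2 2, this 1 1 3 1, this 1 1 4 0,
      this 0 2 0 4, this 0 2 1 3, this 0 2 2 2, this 0 2 3 1, this 0 2 4 0]
  · have := bernstein_terms_nonneg h1 h2 h h4
    linarith [this 2 0 0 4, this 2 0 1 3, this 2 0 2 2, this 2 0 3 1, this 2 0 4 0,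
      this 1 1 0 4, this 1 1 1 3, this 1 1 2 2, this 1 1 3 1, this 1 1 4 0,
      this 0 2 0 4, this 0 2 1 3, this 0 2 2 2, this 0 2 3 1, this 0 2 4 0]

theorem quartic_bound_medium {t r : ℝ} (h1 : 0.08 ≤ t) (h2 : t ≤ 0.16) (h3 : 0 ≤ r) (h4 : r ≤ 1) :
    (5.44 + 9 * t - 4 * r) * ((5.4 * t + 0.245) * r ^ 2 + t * (r * (1 - r ^ 2))) ≤
      8 / 9 * (r + 25 / 4 * t) ^ 2 := by
  rcases le_total r (1 / 2) with h | h
  · have := bernstein_terms_nonneg h1 h2 h3 h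
    linarith [this 2 0 0 4, this 2 0 1 3, this 2 0 2 2, this 2 0 3 1, this 2 0 4 0,
      this 1 1 0 4, this 1 1 1 3, this 1 1 2 2, this 1 1 3 1, this 1 1 4 0,
      this 0 2 0 4, this 0 2 1 3, this 0 2 2 2, this 0 2 3 1, this 0 2 4 0]
  · have := bernstein_terms_nonneg h1 h2 h h4
    linarith [this 2 0 0 4, this 2 0 1 3, this 2 0 2 2, this 2 0 3 1, this 2 0 4 0,
      this 1 1 0 4, this 1 1 1 3, this 1 1 2 2, this 1 1 3 1, this 1 1 4 0,
      this 0 2 0 4, this 0 2 1 3, this 0 2 2 2, this 0 2 3 1, this 0 2 4 0]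

theorem quartic_bound_large {t r : ℝ} (h1 : 0.16 ≤ t) (h2 : t ≤ 0.368) (h3 : 0 ≤ r) (h4 : r ≤ 1) :
    (5.44 + 9 * t - 4 * r) * ((4.4 * t + 0.4038) * r ^ 2 + t * (r * (1 - r ^ 2))) ≤
      8 / 9 * (r + 25 / 4 * t) ^ 2 := by
  rcases le_total r (1 / 2) with h | h
  · have := bernstein_terms_nonneg h1 h2 h3 h
    linarith [this 2 0 0 4, this 2 0 1 3, this 2 0 2 2, this 2 0 3 1, this 2 0 4 0,
      this 1 1 0 4, this 1 1 1 3, this 1 1 2 2, this 1 1 3 1, this 1 1 4 0,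
      this 0 2 0 4, this 0 2 1 3, this 0 2 2 2, this 0 2 3 1, this 0 2 4 0]
  · have := bernstein_terms_nonneg h1 h2 h h4
    linarith [this 2 0 0 4, this 2 0 1 3, this 2 0 2 2, this 2 0 3 1, this 2 0 4 0,
      this 1 1 0 4, this 1 1 1 3, this 1 1 2 2, this 1 1 3 1, this 1 1 4 0,
      this 0 2 0 4, this 0 2 1 3, this 0 2 2 2, this 0 2 3 1, this 0 2 4 0]

/-- No single tangent to `-t log t` is sharp enough on all of `(0, 0.368]`. The contact points `exp
(-2.9)`, `exp (-2.1)` and `exp (-1.6)` serve three subintervals. -/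
theorem exists_tangent {t r : ℝ} (ht : 0 < t) (ht1 : t ≤ 0.368) (h3 : 0 ≤ r) (h4 : r ≤ 1) :
    ∃ l c : ℝ, Real.exp (-l) ≤ c ∧
      (5.44 + 9 * t - 4 * r) *
        (((1.2 + 2 * l) * t + 2 * c) * r ^ 2 + t * (r * (1 - r ^ 2))) ≤
      8 / 9 * (r + 25 / 4 * t) ^ 2 := by
  rcases le_total t 0.08 with h | h
  · refine ⟨29 / 10, 0.05505, ?_, ?_⟩
    · have := exp_neg_le_of_pow 29 10 (by norm_num) 0.05505 (by norm_num) (by norm_num)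
      exact_mod_cast this
    · convert quartic_bound_small ht.le h h3 h4 using 5 <;> norm_num
  rcases le_total t 0.16 with h' | h'
  · refine ⟨21 / 10, 0.1225, ?_, ?_⟩
    · have := exp_neg_le_of_pow 21 10 (by norm_num) 0.1225 (by norm_num) (by norm_num)
      exact_mod_cast this
    · convert quartic_bound_medium h h' h3 h4 using 5 <;> norm_num
  · refine ⟨16 / 10, 0.2019, ?_, ?_⟩
    · have := exp_neg_le_of_pow 16 10 (by norm_num) 0.2019 (by norm_num) (by norm_num)
      exact_mod_cast this
    · convert quartic_bound_large h' ht1 h3 h4 using 5 <;> norm_num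

/-- In the variables `t = κ + H` and `r = H / t` both logarithms separate. A tangent handles `log
t`, the hyperbolic sine bound handles `log r`, and a polynomial inequality in `t` and `r` is left.
-/
theorem sq_mul_log_le_deviation {κ H E : ℝ} (hκ : 0 ≤ κ) (hH : 0 < H) (ht : κ + H ≤ 0.368)
    (hE : E = (κ + H) + 25 / 4 * (κ + H) ^ 2) :
    H ^ 2 * (1 + 2 * Real.log 3 - 2 * Real.log H) ≤
      8 / 9 * (E - κ) ^ 2 / (1.44 * E + 4 * κ) := by
  obtain ⟨t, rfl⟩ : ∃ t, t - H = κ := ⟨κ + H, by ring⟩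
  rw [sub_add_cancel] at ht hE
  obtain ⟨r, hr⟩ : ∃ r, r = H / t := ⟨_, rfl⟩
  have ht0 : 0 < t := by linarith
  obtain rfl : H = t * r := by rw [hr]; field_simp
  have hr0 : 0 < r := by rw [hr]; positivity
  have hr1 : r ≤ 1 := by nlinarith
  obtain ⟨l, c, hc, hP⟩ := exists_tangent ht0 ht hr0.le hr1
  have h1 := neg_log_le_tangent ht0 l c hc
  have h2 := neg_log_le_half hr0 hr1
  have h3 := log_three_le
  have hD : 0 < 5.44 + 9 * t - 4 * r := by nlinarith
  -- Here `1.44 * (25 / 4) = 9`.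
  have hden : 1.44 * E + 4 * (t - t * r) = t * (5.44 + 9 * t - 4 * r) := by rw [hE]; ring
  have hnum : E - (t - t * r) = t * (r + 25 / 4 * t) := by rw [hE]; ring
  rw [hden, hnum, Real.log_mul ht0.ne' hr0.ne', le_div_iff₀ (by positivity)]
  have h4 : r ^ 2 * (-2 * Real.log r) ≤ r * (1 - r ^ 2) := by
    rw [le_div_iff₀ (by positivity)] at h2
    nlinarith
  have h5 : t * (1 + 2 * Real.log 3 - 2 * Real.log t) ≤ (1.2 + 2 * l) * t + 2 * c := by
    nlinarith
  have h6 : r ^ 2 * (t * (1 + 2 * Real.log 3 - 2 * (Real.log t + Real.log r))) ≤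
      ((1.2 + 2 * l) * t + 2 * c) * r ^ 2 + t * (r * (1 - r ^ 2)) := by
    nlinarith [mul_le_mul_of_nonneg_left h5 (sq_nonneg r), mul_le_mul_of_nonneg_left h4 ht0.le]
  have h7 := mul_le_mul_of_nonneg_left h6 hD.le
  have h8 := mul_le_mul_of_nonneg_left (h7.trans hP) (sq_nonneg t)
  nlinarith

/-! ### The choice of the exponential tilt. -/

theorem exp_neg_le_quadratic {s : ℝ} (hs : 0 ≤ s) : Real.exp (-s) ≤ 1 - s + s ^ 2 / 2 := by
  have h := Real.quadratic_le_exp_of_nonneg hs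
  rw [Real.exp_neg]
  refine inv_le_of_inv_le₀ (by nlinarith [sq_nonneg (s - 1)]) (le_trans ?_ h)
  rw [inv_le_iff_one_le_mul₀ (by nlinarith [sq_nonneg (s - 1)])]
  -- `(1 + s + s²/2) * (1 - s + s²/2) = 1 + s⁴/4`.
  nlinarith [sq_nonneg (s ^ 2)]

theorem exp_le_cubic {z : ℝ} (h0 : 0 ≤ z) (h1 : z ≤ 1) :
    Real.exp z ≤ 1 + z + z ^ 2 / 2 + 2 / 9 * z ^ 3 := by
  refine (Real.exp_bound' h0 h1 (n := 3) (by norm_num)).trans (le_of_eq ?_)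
  simp [Finset.sum_range_succ, Nat.factorial]
  ring

/-- This is the price per unit of `κ` when `exp (l + s) = 1 + v` and `9 * s = v / (1 + v)`. The
small coefficient `0.058` keeps the resulting exponent sharp. -/
theorem tilted_growth_le {v : ℝ} (h0 : 0 ≤ v) (h1 : v ≤ 5 / 2) :
    9 * (Real.exp (((1 + v) * Real.exp (-(v / (9 * (1 + v)))) - 1) / 9) - 1) ≤
      8 / 9 * (v + 0.058 * v ^ 2) := by
  have hv : 0 < 1 + v := by linarith
  have h2 : (1 + v) * Real.exp (-(v / (9 * (1 + v)))) - 1 ≤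
      8 / 9 * v + v ^ 2 * (1 - 2 / 7 * v) / 162 := by
    have h := mul_le_mul_of_nonneg_left
      (exp_neg_le_quadratic (s := v / (9 * (1 + v))) (by positivity)) hv.le
    have h' : (1 + v) * (1 - v / (9 * (1 + v)) + (v / (9 * (1 + v))) ^ 2 / 2) =
        1 + 8 / 9 * v + v ^ 2 / 162 * (1 / (1 + v)) := by
      field_simp
      ring
    have h3 : 1 / (1 + v) ≤ 1 - 2 / 7 * v := by
      rw [div_le_iff₀ hv]
      nlinarith
    have := mul_le_mul_of_nonneg_left h3 (by positivity : 0 ≤ v ^ 2 / 162)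
    linarith
  set z := (8 / 9 * v + v ^ 2 * (1 - 2 / 7 * v) / 162) / 9 with hz
  have hz0 : 0 ≤ z := by
    have : 0 ≤ 1 - 2 / 7 * v := by linarith
    positivity
  have hz1 : z ≤ 0.09938 * v := by
    nlinarith [mul_nonneg h0 (sq_nonneg (v - 1.75))]
  have h4 : Real.exp (((1 + v) * Real.exp (-(v / (9 * (1 + v)))) - 1) / 9) ≤
      1 + z + z ^ 2 / 2 + 2 / 9 * z ^ 3 :=
    (Real.exp_le_exp.2 (by rw [hz]; linarith)).trans (exp_le_cubic hz0 (by linarith))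
  have h5 : z ^ 2 ≤ (0.09938 * v) ^ 2 := by gcongr
  have h6 : z ^ 3 ≤ (0.09938 * v) ^ 3 := by gcongr
  have h7 : 0 ≤ v ^ 2 * (5 / 2 - v) := mul_nonneg (sq_nonneg v) (by linarith)
  have h8 : 0 ≤ v ^ 3 := by positivity
  have h9 : 9 * z = 8 / 9 * v + v ^ 2 * (1 - 2 / 7 * v) / 162 := by rw [hz]; ring
  nlinarith

/-- A tilt for which the exponential moments beat the squared excess error. -/
theorem exists_tilt {κ E : ℝ} (hκ : 0 ≤ κ) (hE : κ < E) :
    ∃ l s : ℝ, 0 ≤ l ∧ 0 ≤ s ∧ 9 * s = 1 - Real.exp (-(l + s)) ∧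
      8 / 9 * (E - κ) ^ 2 / (1.44 * E + 4 * κ) ≤
        8 * s * E - κ * (9 * (Real.exp ((Real.exp l - 1) / 9) - 1)) := by
  have hE0 : 0 < E := by linarith
  -- To leading order the gain is `8/9 * (v * E / (1 + v) - κ * v)`, maximal at `1 + v = √(E / κ)`.
  -- The rational substitute `1 + v = (7 * E + 2 * κ) / (2 * E + 7 * κ)` stays bounded when `κ = 0`.
  set v := 5 * (E - κ) / (2 * E + 7 * κ) with hv
  have hden : 0 < 2 * E + 7 * κ := by linarith
  have hv0 : 0 < v := div_pos (by linarith) hden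
  have hv1 : v ≤ 5 / 2 := by
    rw [hv, div_le_iff₀ hden]
    linarith
  have h1v : 0 < 1 + v := by linarith
  have hlog : v / (1 + v) ≤ Real.log (1 + v) := by
    have := Real.one_sub_inv_le_log_of_pos h1v
    refine le_trans (le_of_eq ?_) this
    field_simp
    ring
  have hs0 : 0 ≤ v / (9 * (1 + v)) := by positivity
  have hsle : v / (9 * (1 + v)) ≤ v / (1 + v) := by
    gcongr
    linarith
  refine ⟨Real.log (1 + v) - v / (9 * (1 + v)), v / (9 * (1 + v)), by linarith, hs0, ?_, ?_⟩
  · rw [sub_add_cancel, Real.exp_neg, Real.exp_log h1v]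
    field_simp
    ring
  have h := tilted_growth_le hv0.le hv1
  have h2 := mul_le_mul_of_nonneg_left h hκ
  rw [sub_eq_add_neg (Real.log _), Real.exp_add, Real.exp_log h1v]
  refine le_trans ?_ (sub_le_sub_left h2 _)
  have h3 : 1 + v = (7 * E + 2 * κ) / (2 * E + 7 * κ) := by
    rw [hv]
    field_simp
    ring
  have h4 : 8 * (v / (9 * (1 + v))) * E - κ * (8 / 9 * (v + 0.058 * v ^ 2)) =
      8 / 9 * (E - κ) ^ 2 * (10 * (E + κ) / ((7 * E + 2 * κ) * (2 * E + 7 * κ)) -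
        1.45 * κ / (2 * E + 7 * κ) ^ 2) := by
    have : 0 < 7 * E + 2 * κ := by linarith
    rw [h3, hv]
    field_simp
    ring
  rw [h4, div_eq_mul_one_div]
  refine mul_le_mul_of_nonneg_left ?_ (by positivity)
  have h5 : 0 < 7 * E + 2 * κ := by linarith
  rw [div_sub_div _ _ (by positivity) (by positivity), div_le_div_iff₀ (by positivity)
    (by positivity)]
  have h6 : (7 * E + 2 * κ) * (2 * E + 7 * κ) ^ 2 ≤ (1.44 * E + 4 * κ) *
      (10 * (E + κ) * (2 * E + 7 * κ) - 1.45 * κ * (7 * E + 2 * κ)) := by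
    nlinarith [mul_nonneg hE0.le (sq_nonneg (E - 8 * κ)), mul_nonneg hκ (sq_nonneg (E - 8 * κ)),
      pow_pos hE0 3, pow_nonneg hκ 3, mul_nonneg hE0.le (sq_nonneg (E - 6 * κ))]
  nlinarith [mul_le_mul_of_nonneg_left h6 hden.le]

/-! ### Ghost samples and tilted exponential moments. -/

/-- The zero-one loss. -/
noncomputable def zeroOne (b c : Bool) : ℝ := if b = c then 0 else 1

theorem zeroOne_eq (b c : Bool) : zeroOne b c = 0 ∨ zeroOne b c = 1 := by
  unfold zeroOne
  split <;> simp

theorem ENNReal.tsum_pi_prod {β : Type*} (n : ℕ) (f : Fin n → β → ℝ≥0∞) :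
    ∑' v : Fin n → β, ∏ i, f i (v i) = ∏ i, ∑' b, f i b := by
  induction n with
  | zero =>
    rw [tsum_eq_single (fun i => Fin.elim0 i) fun v hv => (hv (Subsingleton.elim _ _)).elim]
    simp
  | succ n ih =>
    rw [← (Fin.consEquiv fun _ => β).tsum_eq, ENNReal.tsum_prod', Fin.prod_univ_succ]
    simp_rw [Fin.consEquiv, Equiv.coe_fn_mk, Fin.prod_univ_succ, Fin.cons_zero, Fin.cons_succ,
      ENNReal.tsum_mul_left, ih, ENNReal.tsum_mul_right]

theorem ENNReal.tsum_pi_mul_prod {β : Type*} (n : ℕ) (w : β → ℝ≥0∞) (f : Fin n → β → ℝ≥0∞) :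
    ∑' v : Fin n → β, (∏ i, w (v i)) * ∏ i, f i (v i) = ∏ i, ∑' b, w b * f i b := by
  simp_rw [← Finset.prod_mul_distrib]
  exact ENNReal.tsum_pi_prod n fun i b => w b * f i b

/-- Splitting off one entry of each row of a matrix of samples. -/
def splitEntry {Z : Type*} {n k : ℕ} (j : Fin n → Fin (k + 1)) :
    (Fin n → Z) × (Fin n → Fin k → Z) ≃ (Fin n → Fin (k + 1) → Z) :=
  (Equiv.arrowProdEquivProdArrow (Fin n) (fun _ => Z) (fun _ => Fin k → Z)).symm.trans
    (Equiv.piCongrRight fun i => Fin.insertNthEquiv (fun _ => Z) (j i))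

theorem splitEntry_apply {Z : Type*} {n k : ℕ} (j : Fin n → Fin (k + 1)) (v : Fin n → Z)
    (u : Fin n → Fin k → Z) (i : Fin n) :
    splitEntry j (v, u) i = Fin.insertNth (α := fun _ => Z) (j i) (v i) (u i) := rfl

theorem exp_mul_le_affine {E : ℝ} (h0 : 0 ≤ E) (h1 : E ≤ 1) (s : ℝ) :
    Real.exp (s * E) ≤ 1 + (Real.exp s - 1) * E := by
  have := convexOn_exp.2 (Set.mem_univ s) (Set.mem_univ 0) h0 (sub_nonneg.2 h1) (by ring)
  simp only [smul_eq_mul, mul_zero, add_zero, Real.exp_zero, mul_one] at this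
  rw [mul_comm]
  linarith

/-- Averaging over the position of the training point in a row. -/
theorem sum_exp_tilt_le {k : ℕ} {l s : ℝ} (hl : 0 ≤ l) (hs : 0 ≤ s)
    (hls : (k + 1) * s = 1 - Real.exp (-(l + s))) (a e : Fin (k + 1) → ℝ)
    (ha : ∀ i, a i = 0 ∨ a i = 1) (he : ∀ i, e i = 0 ∨ e i = 1) :
    ∑ j, Real.exp (l * a j - l * e j + s * (∑ i, e i - e j)) ≤
      (k + 1) * Real.exp ((Real.exp l - 1) / (k + 1) * ∑ i, a i) := by
  have hk : (0 : ℝ) < k + 1 := by positivity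
  set m := ∑ i, e i
  -- After factoring out `exp (s * m)`, an affine function of `(a j, e j)` interpolates the
  -- exponential at three corners of the unit square and dominates it at `(1, 1)`. By `hls` its
  -- slope in `e j` is `-(k + 1) * s`, so summation over `j` produces `-s * m`. Then `1 + z ≤ exp z`
  -- cancels `exp (s * m)`, and `e` disappears from the bound.
  have hpt : ∀ j, Real.exp (l * a j - l * e j + s * (m - e j)) ≤
      Real.exp (s * m) * (1 + (Real.exp l - 1) * a j - (k + 1) * s * e j) := by
    intro j
    have h1 : Real.exp (l * a j - l * e j + s * (m - e j)) =
        Real.exp (s * m) * Real.exp (l * a j - (l + s) * e j) := by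
      rw [← Real.exp_add]
      ring_nf
    rw [h1, hls]
    refine mul_le_mul_of_nonneg_left ?_ (Real.exp_pos _).le
    rcases ha j with h | h <;> rcases he j with h' | h' <;> rw [h, h']
    · simp
    · simp
    · simp
    · have h2 : Real.exp (l * 1 - (l + s) * 1) = Real.exp l * Real.exp (-(l + s)) := by
        rw [← Real.exp_add]
        ring_nf
      rw [h2]
      have h3 := Real.one_le_exp hl
      have h4 : Real.exp (-(l + s)) ≤ 1 := Real.exp_le_one_iff.2 (by linarith)
      nlinarith
  calc ∑ j, Real.exp (l * a j - l * e j + s * (m - e j))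
      ≤ ∑ j, Real.exp (s * m) * (1 + (Real.exp l - 1) * a j - (k + 1) * s * e j) :=
        Finset.sum_le_sum fun j _ => hpt j
    _ = (k + 1) * (Real.exp (s * m) *
          (((Real.exp l - 1) / (k + 1) * ∑ i, a i - s * m) + 1)) := by
        rw [← Finset.mul_sum, Finset.sum_sub_distrib, Finset.sum_add_distrib, ← Finset.mul_sum,
          ← Finset.mul_sum]
        simp only [Finset.sum_const, Finset.card_univ, Fintype.card_fin, nsmul_eq_mul, mul_one]
        push_cast
        field_simp
        ring
    _ ≤ (k + 1) * (Real.exp (s * m) *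
          Real.exp ((Real.exp l - 1) / (k + 1) * ∑ i, a i - s * m)) := by
        gcongr
        exact Real.add_one_le_exp _
    _ = (k + 1) * Real.exp ((Real.exp l - 1) / (k + 1) * ∑ i, a i) := by
        rw [← Real.exp_add]
        ring_nf

section Weighted

variable {Z : Type*} (p : PMF Z) (c : Z → Bool)

/-- The probability that `h` disagrees with the target `c`. -/
noncomputable def errorProb (h : Z → Bool) : ℝ≥0∞ := ∑' z, p z * ENNReal.ofReal (zeroOne (h z) (c z))

theorem tsum_mul_exp_zeroOne (h : Z → Bool) {s : ℝ} (hs : 0 ≤ s) :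
    ∑' z, p z * ENNReal.ofReal (Real.exp (s * zeroOne (h z) (c z))) =
      1 + ENNReal.ofReal (Real.exp s - 1) * errorProb p c h := by
  have hpt : ∀ z, p z * ENNReal.ofReal (Real.exp (s * zeroOne (h z) (c z))) =
      p z + ENNReal.ofReal (Real.exp s - 1) * (p z * ENNReal.ofReal (zeroOne (h z) (c z))) := by
    intro z
    rcases zeroOne_eq (h z) (c z) with h' | h' <;> rw [h']
    · simp
    · rw [mul_one, ENNReal.ofReal_one, mul_one, mul_comm _ (p z)]
      nth_rw 2 [← mul_one (p z)]
      rw [← mul_add, ← ENNReal.ofReal_one, ← ENNReal.ofReal_add zero_le_one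
        (by linarith [Real.one_le_exp hs])]
      ring_nf
  simp_rw [hpt, ENNReal.tsum_add, ENNReal.tsum_mul_left, p.tsum_coe]
  rfl

theorem errorProb_le_one (h : Z → Bool) : errorProb p c h ≤ 1 := by
  rw [← p.tsum_coe]
  refine ENNReal.tsum_le_tsum fun z => ?_
  rcases zeroOne_eq (h z) (c z) with h' | h' <;> simp [h']

/-- Jensen's inequality, in the form that the exponential lies below its chord on `[0, 1]`. -/
theorem exp_le_tsum_mul_exp (h : Z → Bool) {s E : ℝ} (hs : 0 ≤ s) (hE : 0 ≤ E)
    (hh : ENNReal.ofReal E ≤ errorProb p c h) :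
    ENNReal.ofReal (Real.exp (s * E)) ≤
      ∑' z, p z * ENNReal.ofReal (Real.exp (s * zeroOne (h z) (c z))) := by
  have hE1 : E ≤ 1 := ENNReal.ofReal_le_one.1 (hh.trans (errorProb_le_one p c h))
  rw [tsum_mul_exp_zeroOne p c h hs]
  refine (ENNReal.ofReal_le_ofReal (exp_mul_le_affine hE hE1 s)).trans ?_
  have h1 : 0 ≤ Real.exp s - 1 := by linarith [Real.one_le_exp hs]
  rw [ENNReal.ofReal_add zero_le_one (mul_nonneg h1 hE), ENNReal.ofReal_one,
    ENNReal.ofReal_mul h1]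
  gcongr

theorem tsum_mul_exp_le (h : Z → Bool) {s κ : ℝ} (hs : 0 ≤ s) (hκ : 0 ≤ κ)
    (hh : errorProb p c h ≤ ENNReal.ofReal κ) :
    ∑' z, p z * ENNReal.ofReal (Real.exp (s * zeroOne (h z) (c z))) ≤
      ENNReal.ofReal (Real.exp (κ * (Real.exp s - 1))) := by
  have h1 : 0 ≤ Real.exp s - 1 := by linarith [Real.one_le_exp hs]
  rw [tsum_mul_exp_zeroOne p c h hs]
  calc 1 + ENNReal.ofReal (Real.exp s - 1) * errorProb p c h
      ≤ 1 + ENNReal.ofReal (Real.exp s - 1) * ENNReal.ofReal κ := by gcongr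
    _ = ENNReal.ofReal (κ * (Real.exp s - 1) + 1) := by
      rw [ENNReal.ofReal_add (mul_nonneg hκ h1) zero_le_one, ENNReal.ofReal_one, mul_comm κ,
        ENNReal.ofReal_mul h1, add_comm]
    _ ≤ _ := ENNReal.ofReal_le_ofReal (Real.add_one_le_exp _)

end Weighted

section Ghost

variable {Z : Type*} (p : PMF Z) (c hstar : Z → Bool) (R : Set (Z → Bool))

/-- The restrictions of the functions in `R` to the entries of a matrix of points. -/
noncomputable def traces {n k : ℕ} (w : Fin n → Fin k → Z) : Finset (Fin n → Fin k → Bool) :=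
  open Classical in Finset.univ.filter fun g => ∃ h ∈ R, ∀ i j, h (w i j) = g i j

/-- The weight of a row of points with labels `g` whose entry `j` is used for training. -/
noncomputable def rowWeight {k : ℕ} (l s : ℝ) (u : Fin k → Z) (g : Fin k → Bool) (j : Fin k) :
    ℝ≥0∞ :=
  ENNReal.ofReal (Real.exp (l * zeroOne (hstar (u j)) (c (u j)) - l * zeroOne (g j) (c (u j)) +
    s * (∑ i, zeroOne (g i) (c (u i)) - zeroOne (g j) (c (u j)))))

theorem rowWeight_insertNth {k : ℕ} (l s : ℝ) (h : Z → Bool) (j : Fin (k + 1)) (z : Z)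
    (u : Fin k → Z) :
    rowWeight c hstar l s (Fin.insertNth (α := fun _ => Z) j z u)
      (fun i => h (Fin.insertNth (α := fun _ => Z) j z u i)) j =
      ENNReal.ofReal (Real.exp (l * (zeroOne (hstar z) (c z) - zeroOne (h z) (c z)))) *
        ∏ i, ENNReal.ofReal (Real.exp (s * zeroOne (h (u i)) (c (u i)))) := by
  rw [← ENNReal.ofReal_prod_of_nonneg fun i _ => (Real.exp_pos _).le, ← Real.exp_sum,
    ← ENNReal.ofReal_mul (Real.exp_pos _).le, ← Real.exp_add, rowWeight,
    Fin.sum_univ_succAbove _ j]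
  simp only [Fin.insertNth_apply_same, Fin.insertNth_apply_succAbove, ← Finset.mul_sum]
  ring_nf

theorem prod_rowWeight_le_sum {n k : ℕ} (l s : ℝ) {h : Z → Bool} (hR : h ∈ R)
    (w : Fin n → Fin k → Z) (j : Fin n → Fin k) :
    ∏ i, rowWeight c hstar l s (w i) (fun m => h (w i m)) (j i) ≤
      ∑ g ∈ traces R w, ∏ i, rowWeight c hstar l s (w i) (g i) (j i) := by
  have hmem : (fun i m => h (w i m)) ∈ traces R w := by
    simp only [traces, Finset.mem_filter, Finset.mem_univ, true_and]
    exact ⟨h, hR, fun _ _ => rfl⟩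
  exact Finset.single_le_sum_of_canonicallyOrdered
    (f := fun g : Fin n → Fin k → Bool => ∏ i, rowWeight c hstar l s (w i) (g i) (j i)) hmem

/-- For a bad sample `v` the witness `h` depends on `v` alone. Its weight on the training entries is
at least one, because it trains no worse than `hstar`. Its ghost weight has mean at least `exp (n *
k * s * E)` by Jensen, which the prefactor undoes. Replacing `h` by the sum over all traces makes
the bound independent of the witness. -/
theorem tsum_bad_le_ghost {n k : ℕ} {l s E : ℝ} (hl : 0 ≤ l) (hs : 0 ≤ s) (hE : 0 ≤ E)
    (Bad : Set (Fin n → Z))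
    (hBad : ∀ v ∈ Bad, ∃ h ∈ R, ENNReal.ofReal E ≤ errorProb p c h ∧
      ∑ i, zeroOne (h (v i)) (c (v i)) ≤ ∑ i, zeroOne (hstar (v i)) (c (v i)))
    (j : Fin n → Fin (k + 1)) :
    ∑' v, Bad.indicator (fun v => ∏ i, p (v i)) v ≤
      ENNReal.ofReal (Real.exp (-(n * k * (s * E)))) *
        ∑' w : Fin n → Fin (k + 1) → Z, (∏ i, ∏ m, p (w i m)) *
          ∑ g ∈ traces R w, ∏ i, rowWeight c hstar l s (w i) (g i) (j i) := by
  rw [← (splitEntry j).tsum_eq, ENNReal.tsum_prod', ← ENNReal.tsum_mul_left]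
  refine ENNReal.tsum_le_tsum fun v => ?_
  by_cases hv : v ∈ Bad
  swap
  · simp [hv]
  obtain ⟨h, hR, hErr, hTrain⟩ := hBad v hv
  rw [Set.indicator_of_mem hv]
  have hterm : ∀ u : Fin n → Fin k → Z,
      (∏ i, p (v i)) * ((∏ i, ∏ m, p (u i m)) *
        ∏ i, ∏ m, ENNReal.ofReal (Real.exp (s * zeroOne (h (u i m)) (c (u i m))))) ≤
      (∏ i, ∏ m, p (splitEntry j (v, u) i m)) * ∑ g ∈ traces R (splitEntry j (v, u)),
        ∏ i, rowWeight c hstar l s (splitEntry j (v, u) i) (g i) (j i) := by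
    intro u
    have h1 : ∏ i, ∏ m, p (splitEntry j (v, u) i m) =
        (∏ i, p (v i)) * ∏ i, ∏ m, p (u i m) := by
      rw [← Finset.prod_mul_distrib]
      refine Finset.prod_congr rfl fun i _ => ?_
      rw [splitEntry_apply, Fin.prod_univ_succAbove _ (j i)]
      simp only [Fin.insertNth_apply_same, Fin.insertNth_apply_succAbove]
    rw [h1, ← mul_assoc]
    refine mul_le_mul_right ?_ _
    refine le_trans ?_ (prod_rowWeight_le_sum c hstar R l s hR (splitEntry j (v, u)) j)
    simp only [splitEntry_apply, rowWeight_insertNth]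
    rw [Finset.prod_mul_distrib, ← ENNReal.ofReal_prod_of_nonneg fun i _ => (Real.exp_pos _).le,
      ← Real.exp_sum, ← Finset.mul_sum, Finset.sum_sub_distrib]
    refine le_mul_of_one_le_left zero_le ?_
    rw [ENNReal.one_le_ofReal]
    exact Real.one_le_exp (mul_nonneg hl (sub_nonneg.2 hTrain))
  refine le_trans ?_ (mul_le_mul_right (ENNReal.tsum_le_tsum hterm) _)
  have hsum : ∑' u : Fin n → Fin k → Z, (∏ i, ∏ m, p (u i m)) *
      ∏ i, ∏ m, ENNReal.ofReal (Real.exp (s * zeroOne (h (u i m)) (c (u i m)))) =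
      ∏ _i : Fin n, ∏ _m : Fin k,
        ∑' z, p z * ENNReal.ofReal (Real.exp (s * zeroOne (h z) (c z))) := by
    rw [ENNReal.tsum_pi_mul_prod n (fun u : Fin k → Z => ∏ m, p (u m))
      fun _ u => ∏ m, ENNReal.ofReal (Real.exp (s * zeroOne (h (u m)) (c (u m))))]
    refine Finset.prod_congr rfl fun i _ => ?_
    exact ENNReal.tsum_pi_mul_prod k p fun _ z =>
      ENNReal.ofReal (Real.exp (s * zeroOne (h z) (c z)))
  rw [ENNReal.tsum_mul_left, hsum, mul_left_comm]
  refine le_mul_of_one_le_right zero_le ?_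
  simp only [Finset.prod_const, Finset.card_univ, Fintype.card_fin]
  calc (1 : ℝ≥0∞) = ENNReal.ofReal (Real.exp (-(n * k * (s * E)))) *
        ((ENNReal.ofReal (Real.exp (s * E))) ^ k) ^ n := by
        rw [← ENNReal.ofReal_pow (Real.exp_pos _).le, ← ENNReal.ofReal_pow (by positivity),
          ← ENNReal.ofReal_mul (Real.exp_pos _).le, ← Real.exp_nat_mul, ← Real.exp_nat_mul,
          ← Real.exp_add]
        ring_nf
        simp
    _ ≤ _ := by
        gcongr
        exact exp_le_tsum_mul_exp p c h hs hE hErr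

/-- A uniform deviation bound relative to a fixed comparison function. -/
theorem tsum_bad_le {n k : ℕ} {l s E κ : ℝ} (hl : 0 ≤ l) (hs : 0 ≤ s) (hE : 0 ≤ E) (hκ : 0 ≤ κ)
    (hls : (k + 1) * s = 1 - Real.exp (-(l + s)))
    (hstar_le : errorProb p c hstar ≤ ENNReal.ofReal κ)
    (Bad : Set (Fin n → Z))
    (hBad : ∀ v ∈ Bad, ∃ h ∈ R, ENNReal.ofReal E ≤ errorProb p c h ∧
      ∑ i, zeroOne (h (v i)) (c (v i)) ≤ ∑ i, zeroOne (hstar (v i)) (c (v i)))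
    (S : ℝ) (hS : ∀ w : Fin n → Fin (k + 1) → Z, ((traces R w).card : ℝ) ≤ S) :
    ∑' v, Bad.indicator (fun v => ∏ i, p (v i)) v ≤
      ENNReal.ofReal (S * Real.exp (-(n * (k * s * E -
        κ * ((k + 1) * (Real.exp ((Real.exp l - 1) / (k + 1)) - 1)))))) := by
  set θ := (Real.exp l - 1) / (k + 1) with hθ
  have hθ0 : 0 ≤ θ := div_nonneg (by linarith [Real.one_le_exp hl]) (by positivity)
  have hrow : ∀ (u : Fin (k + 1) → Z) (g : Fin (k + 1) → Bool),
      ∑ j, rowWeight c hstar l s u g j ≤ ((k + 1 : ℕ) : ℝ≥0∞) *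
        ∏ m, ENNReal.ofReal (Real.exp (θ * zeroOne (hstar (u m)) (c (u m)))) := by
    intro u g
    have := sum_exp_tilt_le hl hs hls (fun i => zeroOne (hstar (u i)) (c (u i)))
      (fun i => zeroOne (g i) (c (u i))) (fun _ => zeroOne_eq _ _) fun _ => zeroOne_eq _ _
    simp only [rowWeight]
    rw [← ENNReal.ofReal_prod_of_nonneg fun i _ => (Real.exp_pos _).le, ← Real.exp_sum,
      ← Finset.mul_sum, ← ENNReal.ofReal_sum_of_nonneg fun i _ => (Real.exp_pos _).le,
      ← ENNReal.ofReal_natCast, ← ENNReal.ofReal_mul (by positivity)]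
    refine ENNReal.ofReal_le_ofReal ?_
    push_cast
    exact this
  set P := ∑' v, Bad.indicator (fun v => ∏ i, p (v i)) v with hP
  set W : (Fin n → Fin (k + 1) → Z) → ℝ≥0∞ := fun w => ∏ i, ∏ m, p (w i m) with hW
  -- The ghost bound holds for every placement `j` of the training points. Summing over all `(k + 1)
  -- ^ n` placements turns the product over rows into a product of row sums.
  have h1 : (((k + 1) ^ n : ℕ) : ℝ≥0∞) * P ≤
      ENNReal.ofReal (Real.exp (-(n * k * (s * E)))) *
        ∑' w : Fin n → Fin (k + 1) → Z, W w *
          ∑ g ∈ traces R w, ∏ i, ∑ j, rowWeight c hstar l s (w i) (g i) j := by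
    calc (((k + 1) ^ n : ℕ) : ℝ≥0∞) * P = ∑ _j : Fin n → Fin (k + 1), P := by
          simp
      _ ≤ ∑ j : Fin n → Fin (k + 1), ENNReal.ofReal (Real.exp (-(n * k * (s * E)))) *
          ∑' w : Fin n → Fin (k + 1) → Z, W w *
          ∑ g ∈ traces R w, ∏ i, rowWeight c hstar l s (w i) (g i) (j i) :=
          Finset.sum_le_sum fun j _ => tsum_bad_le_ghost p c hstar R hl hs hE Bad hBad j
      _ = _ := by
          rw [← Finset.mul_sum, ← Summable.tsum_finsetSum fun _ _ => ENNReal.summable]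
          congr 2
          funext w
          rw [← Finset.mul_sum, Finset.sum_comm]
          congr 1
          refine Finset.sum_congr rfl fun g _ => ?_
          rw [Finset.prod_univ_sum]
          simp
  have h2 : ∀ w : Fin n → Fin (k + 1) → Z, W w *
      ∑ g ∈ traces R w, ∏ i, ∑ j, rowWeight c hstar l s (w i) (g i) j ≤
      (((k + 1) ^ n : ℕ) : ℝ≥0∞) * ENNReal.ofReal S *
        (W w * ∏ i, ∏ m, ENNReal.ofReal (Real.exp (θ * zeroOne (hstar (w i m)) (c (w i m))))) := by
    intro w
    rw [mul_left_comm]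
    refine mul_le_mul_right ?_ _
    calc ∑ g ∈ traces R w, ∏ i, ∑ j, rowWeight c hstar l s (w i) (g i) j
        ≤ ∑ g ∈ traces R w, ∏ i, (((k + 1 : ℕ) : ℝ≥0∞) *
          ∏ m, ENNReal.ofReal (Real.exp (θ * zeroOne (hstar (w i m)) (c (w i m))))) := by
          gcongr
          exact hrow _ _
      _ = ((traces R w).card : ℝ≥0∞) * ((((k + 1) ^ n : ℕ) : ℝ≥0∞) *
          ∏ i, ∏ m, ENNReal.ofReal (Real.exp (θ * zeroOne (hstar (w i m)) (c (w i m))))) := by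
          rw [Finset.sum_const, nsmul_eq_mul, Finset.prod_mul_distrib]
          simp
      _ ≤ ENNReal.ofReal S * ((((k + 1) ^ n : ℕ) : ℝ≥0∞) *
          ∏ i, ∏ m, ENNReal.ofReal (Real.exp (θ * zeroOne (hstar (w i m)) (c (w i m))))) := by
          gcongr
          rw [← ENNReal.ofReal_natCast]
          exact ENNReal.ofReal_le_ofReal (hS w)
      _ = _ := by ring
  have h3 : ∑' w : Fin n → Fin (k + 1) → Z, W w *
      ∏ i, ∏ m, ENNReal.ofReal (Real.exp (θ * zeroOne (hstar (w i m)) (c (w i m)))) ≤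
      ENNReal.ofReal (Real.exp (n * (κ * ((k + 1) * (Real.exp θ - 1))))) := by
    rw [ENNReal.tsum_pi_mul_prod n (fun u : Fin (k + 1) → Z => ∏ m, p (u m))
      fun _ u => ∏ m, ENNReal.ofReal (Real.exp (θ * zeroOne (hstar (u m)) (c (u m))))]
    simp_rw [ENNReal.tsum_pi_mul_prod (k + 1) p fun _ z =>
      ENNReal.ofReal (Real.exp (θ * zeroOne (hstar z) (c z)))]
    simp only [Finset.prod_const, Finset.card_univ, Fintype.card_fin]
    calc _ ≤ (ENNReal.ofReal (Real.exp (κ * (Real.exp θ - 1))) ^ (k + 1)) ^ n := by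
          gcongr
          exact tsum_mul_exp_le p c hstar hθ0 hκ hstar_le
      _ = _ := by
          rw [← ENNReal.ofReal_pow (Real.exp_pos _).le, ← ENNReal.ofReal_pow (by positivity),
            ← Real.exp_nat_mul, ← Real.exp_nat_mul]
          push_cast
          ring_nf
  have hS0 : 0 ≤ S := by
    rcases isEmpty_or_nonempty (Fin n → Fin (k + 1) → Z) with h | ⟨⟨w⟩⟩
    · obtain ⟨z, _⟩ := p.support_nonempty
      exact (h.false fun _ _ => z).elim
    · exact (Nat.cast_nonneg _).trans (hS w)
  have h4 : (((k + 1) ^ n : ℕ) : ℝ≥0∞) * P ≤ (((k + 1) ^ n : ℕ) : ℝ≥0∞) *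
      ENNReal.ofReal (S * Real.exp (-(n * (k * s * E -
        κ * ((k + 1) * (Real.exp θ - 1)))))) := by
    calc _ ≤ _ := h1
      _ ≤ ENNReal.ofReal (Real.exp (-(n * k * (s * E)))) *
          ((((k + 1) ^ n : ℕ) : ℝ≥0∞) * ENNReal.ofReal S *
          ENNReal.ofReal (Real.exp (n * (κ * ((k + 1) * (Real.exp θ - 1)))))) := by
          refine mul_le_mul_right ?_ _
          refine (ENNReal.tsum_le_tsum h2).trans ?_
          rw [ENNReal.tsum_mul_left]
          exact mul_le_mul_right h3 _
      _ = _ := by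
          rw [mul_left_comm, mul_assoc, ← ENNReal.ofReal_mul (Real.exp_pos _).le,
            mul_assoc, ← ENNReal.ofReal_mul hS0, ← Real.exp_add]
          ring_nf
  exact (ENNReal.mul_le_mul_iff_right (by positivity) (ENNReal.natCast_ne_top _)).1 h4

end Ghost

/-! ### Counting restrictions: the Sauer-Shelah bound. -/

section Sauer

/-- Weighting the `i`-th term by `(d / m) ^ i` costs at most the factor `(m / d) ^ d`, and the
weighted binomial sum is `(1 + d / m) ^ m ≤ exp d`. For `d = 0` the right side is a zeroth power, so
the division by zero is harmless. -/
theorem sum_choose_le (m d : ℕ) (hd : d ≤ m) :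
    ((∑ i ∈ Finset.Iic d, m.choose i : ℕ) : ℝ) ≤ (Real.exp 1 * m / d) ^ d := by
  rcases Nat.eq_zero_or_pos d with rfl | hd0
  · simp [Finset.sum_eq_single_of_mem (s := Finset.Iic 0) 0 (by simp)
      (fun b hb hb' => absurd (Nat.le_zero.1 (Finset.mem_Iic.1 hb)) hb')]
  have hdR : (0 : ℝ) < d := by exact_mod_cast hd0
  have hmR : (0 : ℝ) < m := by exact_mod_cast hd0.trans_le hd
  have hle : (1 : ℝ) ≤ m / d := by
    rw [one_le_div hdR]
    exact_mod_cast hd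
  have hterm : ∀ i ∈ Finset.Iic d,
      (m.choose i : ℝ) ≤ (m / d : ℝ) ^ d * (m.choose i * (d / m : ℝ) ^ i) := by
    intro i hi
    have hid := Finset.mem_Iic.1 hi
    have h1 : (1 : ℝ) ≤ (m / d : ℝ) ^ d * (d / m : ℝ) ^ i := by
      have h2 : (m / d : ℝ) ^ i * (d / m : ℝ) ^ i = 1 := by
        rw [← mul_pow, div_mul_div_cancel₀ hdR.ne', div_self hmR.ne', one_pow]
      rw [← h2]
      gcongr
    nlinarith [Nat.cast_nonneg (α := ℝ) (m.choose i)]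
  push_cast
  calc ∑ i ∈ Finset.Iic d, (m.choose i : ℝ)
      ≤ ∑ i ∈ Finset.Iic d, (m / d : ℝ) ^ d * (m.choose i * (d / m : ℝ) ^ i) :=
        Finset.sum_le_sum hterm
    _ ≤ ∑ i ∈ Finset.range (m + 1), (m / d : ℝ) ^ d * (m.choose i * (d / m : ℝ) ^ i) := by
        refine Finset.sum_le_sum_of_subset_of_nonneg ?_ fun _ _ _ => by positivity
        intro i hi
        have := Finset.mem_Iic.1 hi
        exact Finset.mem_range.2 (by omega)
    _ = (m / d : ℝ) ^ d * (d / m + 1 : ℝ) ^ m := by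
        rw [← Finset.mul_sum, add_pow]
        simp [mul_comm]
    _ ≤ (m / d : ℝ) ^ d * Real.exp 1 ^ d := by
        gcongr
        calc (d / m + 1 : ℝ) ^ m ≤ Real.exp (d / m) ^ m := by
              gcongr
              exact Real.add_one_le_exp _
          _ = Real.exp 1 ^ d := by
              rw [← Real.exp_nat_mul, ← Real.exp_nat_mul]
              field_simp
    _ = (Real.exp 1 * m / d) ^ d := by
        rw [← mul_pow]
        ring_nf

variable {Z : Type*} (R : Set (Z → Bool))

theorem card_le_vcDim (hVC : BestOfN.vcDim R ≠ ⊤) (s : Finset Z) (hs : BestOfN.Shattered R s) :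
    s.card ≤ (BestOfN.vcDim R).toNat := by
  have h : (s.card : ℕ∞) ≤ BestOfN.vcDim R :=
    le_iSup₂ (f := fun (s : Finset Z) (_ : s ∈ {s : Finset Z | BestOfN.Shattered R s}) =>
      (s.card : ℕ∞)) s hs
  rw [← ENat.natCast_toNat hVC] at h
  exact_mod_cast h

/-- The Sauer-Shelah bound for the number of restrictions to a matrix of points. -/
theorem card_traces_le {n k : ℕ} (hVC : BestOfN.vcDim R ≠ ⊤) (w : Fin n → Fin k → Z)
    (hd : (BestOfN.vcDim R).toNat ≤ n * k) :
    ((traces R w).card : ℝ) ≤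
      (Real.exp 1 * (n * k) / (BestOfN.vcDim R).toNat) ^ (BestOfN.vcDim R).toNat := by
  classical
  set d := (BestOfN.vcDim R).toNat with hd_def
  let φ : (Fin n → Fin k → Bool) → Finset (Fin n × Fin k) :=
    fun g => Finset.univ.filter fun q => g q.1 q.2 = true
  have hφ : Function.Injective φ := by
    intro g g' h
    funext i j
    have := Finset.ext_iff.1 h (i, j)
    simp only [φ, Finset.mem_filter, Finset.mem_univ, true_and] at this
    exact Bool.eq_iff_iff.2 this
  set 𝒜 := (traces R w).image φ with h𝒜
  have hcard : 𝒜.card = (traces R w).card := Finset.card_image_of_injective _ hφ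
  have hshat : ∀ s : Finset (Fin n × Fin k), 𝒜.Shatters s → s.card ≤ d := by
    intro s hs
    have hex : ∀ t ⊆ s, ∃ h ∈ R, ∀ q ∈ s, h (w q.1 q.2) = true ↔ q ∈ t := by
      intro t ht
      obtain ⟨u, hu, hut⟩ := hs ht
      obtain ⟨g, hg, rfl⟩ := Finset.mem_image.1 hu
      simp only [traces, Finset.mem_filter, Finset.mem_univ, true_and] at hg
      obtain ⟨h, hR, hg⟩ := hg
      refine ⟨h, hR, fun q hq => ?_⟩
      rw [hg, ← hut]
      simp [φ, hq]
    -- Two positions holding the same point always receive the same label, so a shattered set of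
    -- positions holds distinct points and its image in `Z` has the same size.
    have hinj : Set.InjOn (fun q : Fin n × Fin k => w q.1 q.2) s := by
      intro q hq q' hq' hqq
      obtain ⟨h, _, hh⟩ := hex {q} (Finset.singleton_subset_iff.2 hq)
      have h1 := (hh q hq).2 (Finset.mem_singleton_self q)
      have hqq' : w q.1 q.2 = w q'.1 q'.2 := hqq
      rw [hqq'] at h1
      exact (Finset.mem_singleton.1 ((hh q' hq').1 h1)).symm
    rw [← Finset.card_image_of_injOn hinj]
    refine card_le_vcDim R hVC _ fun g => ?_
    obtain ⟨h, hR, hh⟩ := hex (s.filter fun q => g (w q.1 q.2) = true) (Finset.filter_subset _ _)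
    refine ⟨h, hR, fun z hz => ?_⟩
    obtain ⟨q, hq, rfl⟩ := Finset.mem_image.1 hz
    have := hh q hq
    rw [Finset.mem_filter] at this
    exact Bool.eq_iff_iff.2 (this.trans (and_iff_right hq))
  have h1 : (traces R w).card ≤ ∑ i ∈ Finset.Iic d, (n * k).choose i := by
    rw [← hcard]
    refine 𝒜.card_le_card_shatterer.trans ?_
    refine Finset.card_shatterer_le_sum_vcDim.trans ?_
    have hvc : 𝒜.vcDim ≤ d := Finset.sup_le fun s hs => hshat s (Finset.mem_shatterer.1 hs)
    simp only [Fintype.card_prod, Fintype.card_fin]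
    exact Finset.sum_le_sum_of_subset (Finset.Iic_subset_Iic.2 hvc)
  have h2 := sum_choose_le (n * k) d hd
  push_cast at h2 h1
  exact (by exact_mod_cast h1 : ((traces R w).card : ℝ) ≤ _).trans h2

end Sauer

/-! ### The excess risk of empirical risk minimizers. -/

section

open Filter Topology

section Uniform

/-- Substituting `n = (d + L) / H ^ 2` turns the logarithm of the growth bound into `d * (1 + 2 log
3 - 2 log H) + d * log ((d + L) / d)`, whose last term is at most `L`. The hypothesis on `G`
supplies the same bracket with factor `d + L`, and its extra `L` copies, the bracket being at least
`2`, pay for this `L` and for `exp (-L)`. -/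
theorem growth_mul_exp_le {d n : ℕ} {L H G : ℝ} (hn : 0 < n) (hL : 0 < L)
    (hH : H = √((d + L) / n)) (hH1 : H ≤ 1)
    (hG : H ^ 2 * (1 + 2 * Real.log 3 - 2 * Real.log H) ≤ G) :
    d ≤ n * 9 ∧
      (Real.exp 1 * (n * (9 : ℕ)) / d) ^ d * Real.exp (-(n * G)) ≤ Real.exp (-L) := by
  have hnR : (0 : ℝ) < n := by exact_mod_cast hn
  have hD : 0 < (d + L) / n := by positivity
  have hH0 : 0 < H := by rw [hH]; exact Real.sqrt_pos.2 hD
  have hHsq : n * H ^ 2 = d + L := by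
    rw [hH, Real.sq_sqrt hD.le]
    field_simp
  have hlogH : Real.log H ≤ 0 := Real.log_nonpos hH0.le hH1
  have hH2 : H ^ 2 ≤ 1 := by nlinarith
  have hdn : (d : ℝ) ≤ n := by nlinarith
  have hlog3 : 1 / 2 ≤ Real.log 3 := by
    have := Real.one_sub_inv_le_log_of_pos (by norm_num : (0 : ℝ) < 3)
    norm_num at this
    linarith
  have hnG : (d + L) * (1 + 2 * Real.log 3 - 2 * Real.log H) ≤ n * G := by
    rw [← hHsq, mul_assoc]
    gcongr
  refine ⟨?_, ?_⟩
  · have : d ≤ n := by exact_mod_cast hdn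
    omega
  rcases Nat.eq_zero_or_pos d with rfl | hd
  · rw [pow_zero, one_mul]
    refine Real.exp_le_exp.2 ?_
    push_cast at hnG
    nlinarith
  have hdR : (0 : ℝ) < d := by exact_mod_cast hd
  have hbase : Real.exp 1 * (n * (9 : ℕ)) / d =
      Real.exp (1 + 2 * Real.log 3 - 2 * Real.log H + Real.log ((d + L) / d)) := by
    rw [Real.exp_add, Real.exp_sub, Real.exp_add, Real.exp_log (by positivity), two_mul, two_mul,
      Real.exp_add, Real.exp_add, Real.exp_log (by norm_num), Real.exp_log hH0, ← hHsq]
    field_simp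
    norm_num
  rw [hbase, ← Real.exp_nat_mul, ← Real.exp_add]
  refine Real.exp_le_exp.2 ?_
  have h1 : d * Real.log ((d + L) / d) ≤ L := by
    have := Real.log_le_sub_one_of_pos (show 0 < (d + L) / d by positivity)
    calc d * Real.log ((d + L) / d) ≤ d * ((d + L) / d - 1) := by gcongr
      _ = L := by field_simp; ring
  nlinarith

variable {Z : Type*} (p : PMF Z) (c : Z → Bool) (R : Set (Z → Bool))

/-- Empirical risk minimizers have small excess risk. -/
theorem tsum_erm_error_le (hR : R.Nonempty) (hVC : BestOfN.vcDim R ≠ ⊤) {n : ℕ} (hn : 0 < n)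
    {L κ H : ℝ} (hL : 0 < L) (hκ : κ = sInf ((fun h => (errorProb p c h).toReal) '' R))
    (hH : H = √(((BestOfN.vcDim R).toNat + L) / n)) (ht : κ + H ≤ 0.368) :
    ∑' v, {v : Fin n → Z | ∃ h ∈ R,
        (κ + H) + 25 / 4 * (κ + H) ^ 2 < (errorProb p c h).toReal ∧
        ∀ h' ∈ R, ∑ i, zeroOne (h (v i)) (c (v i)) ≤
          ∑ i, zeroOne (h' (v i)) (c (v i))}.indicator (fun v => ∏ i, p (v i)) v ≤
      ENNReal.ofReal (Real.exp (-L)) := by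
  have hnR : (0 : ℝ) < n := by exact_mod_cast hn
  have hκ0 : 0 ≤ κ := by
    rw [hκ]
    exact Real.sInf_nonneg (by rintro _ ⟨h, _, rfl⟩; exact ENNReal.toReal_nonneg)
  have hH0 : 0 < H := by rw [hH]; exact Real.sqrt_pos.2 (by positivity)
  obtain ⟨E, hE⟩ : ∃ E, E = (κ + H) + 25 / 4 * (κ + H) ^ 2 := ⟨_, rfl⟩
  have hE0 : κ < E := by rw [hE]; nlinarith
  rw [← hE]
  obtain ⟨l, s, hl, hs, hls, htilt⟩ := exists_tilt hκ0 hE0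
  have hdev := (sq_mul_log_le_deviation hκ0 hH0 ht hE).trans htilt
  obtain ⟨hdn, hbound⟩ := growth_mul_exp_le hn hL hH (by linarith) hdev
  refine le_trans ?_ (ENNReal.ofReal_le_ofReal hbound)
  -- The infimum `κ` need not be attained. The comparison function is taken with error below some
  -- `κ' > κ`, and then `κ'` decreases to `κ`.
  have hlim : Tendsto (fun κ' : ℝ => ENNReal.ofReal
      ((Real.exp 1 * (n * (9 : ℕ)) / (BestOfN.vcDim R).toNat) ^ (BestOfN.vcDim R).toNat *
        Real.exp (-(n * (8 * s * E - κ' * (9 * (Real.exp ((Real.exp l - 1) / 9) - 1)))))))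
      (𝓝[>] κ) (𝓝 (ENNReal.ofReal
      ((Real.exp 1 * (n * (9 : ℕ)) / (BestOfN.vcDim R).toNat) ^ (BestOfN.vcDim R).toNat *
        Real.exp (-(n * (8 * s * E - κ * (9 * (Real.exp ((Real.exp l - 1) / 9) - 1)))))))) := by
    exact tendsto_nhdsWithin_of_tendsto_nhds
      ((ENNReal.continuous_ofReal.comp (by fun_prop)).tendsto κ)
  refine ge_of_tendsto hlim (eventually_mem_nhdsWithin.mono fun κ' hκ' => ?_)
  have hκ'' : sInf ((fun h => (errorProb p c h).toReal) '' R) < κ' := by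
    rw [← hκ]
    exact hκ'
  obtain ⟨_, ⟨g, hg, rfl⟩, hgκ⟩ := exists_lt_of_csInf_lt (hR.image _) hκ''
  have hfin : ∀ h, errorProb p c h ≠ ⊤ := fun h =>
    ne_top_of_le_ne_top ENNReal.one_ne_top (errorProb_le_one p c h)
  -- An empirical minimizer trains no worse than any `g` in the class, so one fixed comparison
  -- function covers all bad samples.
  have := tsum_bad_le (n := n) (k := 8) (E := E) (κ := κ') p c g R hl hs (hκ0.trans hE0.le)
    (hκ0.trans (le_of_lt hκ')) (by push_cast; linarith)
    ((ENNReal.le_ofReal_iff_toReal_le (hfin g)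
      (hκ0.trans (le_of_lt hκ'))).2 hgκ.le) {v : Fin n → Z | ∃ h ∈ R,
        E < (errorProb p c h).toReal ∧
        ∀ h' ∈ R, ∑ i, zeroOne (h (v i)) (c (v i)) ≤ ∑ i, zeroOne (h' (v i)) (c (v i))}
    (fun v ⟨h, hhR, hhE, hmin⟩ => ⟨h, hhR,
      (ENNReal.ofReal_le_iff_le_toReal (hfin h)).2 hhE.le, hmin g hg⟩)
    _ (fun w => card_traces_le R hVC w (by simpa using hdn))
  refine this.trans (le_of_eq ?_)
  norm_num

end Uniform

end

/-! ### Affine upper bounds for the failure probability at one prompt. -/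

section Pointwise

/-- By convexity the power lies below its chord over `[x, 1]`, whose slope is the geometric sum. -/
theorem add_pow_le_chord {x b : ℝ} (hx : 0 ≤ x) (hb : 0 ≤ b) (h : x + b ≤ 1) (M : ℕ) :
    (x + b) ^ M ≤ x ^ M + b * ∑ j ∈ Finset.range M, x ^ j := by
  have h1 := (Commute.all (x + b) x).geom_sum₂_mul M
  have h2 : ∑ i ∈ Finset.range M, (x + b) ^ i * x ^ (M - 1 - i) ≤
      ∑ j ∈ Finset.range M, x ^ j := by
    rw [← Finset.sum_range_reflect (fun j => x ^ j)]
    refine Finset.sum_le_sum fun i _ => mul_le_of_le_one_left (by positivity) ?_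
    exact pow_le_one₀ (by linarith) h
  rw [add_sub_cancel_left] at h1
  nlinarith

theorem tangent_le_add_pow {y a : ℝ} (hy : 0 ≤ y) (ha : 0 ≤ a) (M : ℕ) :
    y ^ M + a * (M * y ^ (M - 1)) ≤ (y + a) ^ M := by
  have h1 := (Commute.all (y + a) y).geom_sum₂_mul M
  have h2 : (M : ℝ) * y ^ (M - 1) ≤ ∑ i ∈ Finset.range M, (y + a) ^ i * y ^ (M - 1 - i) := by
    rw [← nsmul_eq_mul, ← Finset.card_range M, ← Finset.sum_const, Finset.card_range]
    refine Finset.sum_le_sum fun i hi => ?_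
    have : M - 1 = i + (M - 1 - i) := by
      have := Finset.mem_range.1 hi
      omega
    nth_rw 1 [this]
    rw [pow_add]
    gcongr
    linarith
  rw [add_sub_cancel_left] at h1
  nlinarith

/-- The failure probability of Best-of-`(M + 1)`, where `a`, `u` and `b` are the probabilities of
a bad response with high score, a bad response with low score, and a good response with low
score. -/
def failureProb (M : ℕ) (a u b : ℝ) : ℝ :=
  (u + b) ^ M * u + a * ∑ j ∈ Finset.range (M + 1), (u + b) ^ j

/-- The failure probability increases in `u` and in `u + b`, so these are replaced by `x - a` and `y
= x + b' - a`, giving `x * y ^ M + a * ∑ j < M, y ^ j`. By `hK` the sum costs `x * M * y ^ (M - 1)`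
plus `K`. The first part completes a tangent, so `x * (y + a) ^ M = x * (x + b') ^ M` bounds it, and
the chord bound finishes. -/
theorem failureProb_le {M : ℕ} {x a u b K : ℝ} (ha : 0 ≤ a) (hu : 0 ≤ u) (hb : 0 ≤ b)
    (hx1 : x ≤ 1) (hau : a + u ≤ x) (h1 : a + u + b ≤ 1)
    (hK : ∀ y : ℝ, 0 ≤ y → y ≤ 1 → ∑ j ∈ Finset.range M, y ^ j ≤ x * (M * y ^ (M - 1)) + K) :
    ∃ b', 0 ≤ b' ∧ b' ≤ b ∧ b' ≤ 1 - x ∧ failureProb M a u b ≤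
      x ^ (M + 1) + (x * ∑ j ∈ Finset.range M, x ^ j) * b' + K * a := by
  have hx : 0 ≤ x := by linarith
  refine ⟨min b (1 - x), le_min hb (by linarith), min_le_left _ _, min_le_right _ _, ?_⟩
  obtain ⟨b', hb'⟩ : ∃ b', b' = min b (1 - x) := ⟨_, rfl⟩
  rw [← hb']
  have hb0 : 0 ≤ b' := by rw [hb']; exact le_min hb (by linarith)
  have hb1 : b' ≤ 1 - x := by rw [hb']; exact min_le_right _ _
  -- If the minimum is `b` this is `a + u ≤ x`; if it is `1 - x` this is `a + u + b ≤ 1`.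
  have hy : u + b ≤ x + b' - a := by
    rw [hb']
    rcases min_cases b (1 - x) with ⟨h, _⟩ | ⟨h, _⟩ <;> rw [h] <;> linarith
  obtain ⟨y, hy'⟩ : ∃ y, y = x + b' - a := ⟨_, rfl⟩
  rw [← hy'] at hy
  have hub : 0 ≤ u + b := by linarith
  have hy0 : 0 ≤ y := by linarith
  have hy1 : y ≤ 1 := by linarith
  have h2 : failureProb M a u b ≤ y ^ M * (x - a) + a * ∑ j ∈ Finset.range (M + 1), y ^ j := by
    unfold failureProb
    gcongr
    linarith
  rw [Finset.sum_range_succ] at h2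
  have h3 := mul_le_mul_of_nonneg_left (hK y hy0 hy1) ha
  have h4 := tangent_le_add_pow hy0 ha M
  have h5 : y + a = x + b' := by rw [hy']; ring
  rw [h5] at h4
  have h6 := add_pow_le_chord hx hb0 (by linarith) M
  have h7 := mul_le_mul_of_nonneg_left (h4.trans h6) hx
  rw [pow_succ]
  nlinarith

/-- Pair `y ^ j` with `y ^ (M - 1 - j)` and use `(1 - y ^ j) * (1 - y ^ (M - 1 - j)) ≥ 0`. -/
theorem geom_sum_le_half {y : ℝ} (h0 : 0 ≤ y) (h1 : y ≤ 1) (M : ℕ) :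
    ∑ j ∈ Finset.range M, y ^ j ≤ M / 2 * (1 + y ^ (M - 1)) := by
  have h2 : ∑ j ∈ Finset.range M, (y ^ j + y ^ (M - 1 - j)) ≤
      ∑ _j ∈ Finset.range M, (1 + y ^ (M - 1)) := by
    refine Finset.sum_le_sum fun j hj => ?_
    have : M - 1 = j + (M - 1 - j) := by
      have := Finset.mem_range.1 hj
      omega
    nth_rw 2 [this]
    rw [pow_add]
    nlinarith [pow_le_one₀ h0 h1 (n := j), pow_le_one₀ h0 h1 (n := M - 1 - j)]
  rw [Finset.sum_add_distrib, Finset.sum_range_reflect (fun j => y ^ j), Finset.sum_const,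
    Finset.card_range, nsmul_eq_mul] at h2
  linarith

theorem geom_sum_le_max {x y : ℝ} (h0 : 0 ≤ y) (h1 : y ≤ 1) (M : ℕ) :
    ∑ j ∈ Finset.range M, y ^ j ≤ x * (M * y ^ (M - 1)) + M * max (1 / 2) (1 - x) := by
  have h := geom_sum_le_half h0 h1 M
  have hM : (0 : ℝ) ≤ M := Nat.cast_nonneg M
  have hy := pow_le_one₀ h0 h1 (n := M - 1)
  have hy0 : 0 ≤ y ^ (M - 1) := by positivity
  refine h.trans ?_
  rcases le_total (1 / 2) (1 - x) with h' | h'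
  · rw [max_eq_right h']
    nlinarith [mul_nonneg hM (mul_nonneg (sub_nonneg.2 hy) (sub_nonneg.2 h'))]
  · rw [max_eq_left h']
    nlinarith [mul_nonneg hM (mul_nonneg hy0 (sub_nonneg.2 h'))]

end Pointwise

/-! ### Reduction to slope inequalities, and their proofs. -/

section Trade

/-- The bound on the failure probability is monotone up to the worst case `s = x ^ M`. -/
theorem log_sub_le_log_sub {q u : ℝ} (hq : 0 < q) (hqu : q ≤ u) (hu : u ≤ 1) :
    Real.log q - q ≤ Real.log u - u := by
  have hu0 : 0 < u := hq.trans_le hqu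
  have h := Real.one_sub_inv_le_log_of_pos (div_pos hu0 hq)
  rw [Real.log_div hu0.ne' hq.ne', inv_div] at h
  have h2 : u - q ≤ 1 - q / u := by
    rw [one_sub_div hu0.ne', le_div_iff₀ hu0]
    nlinarith
  linarith

/-- Monotonicity of `log v - v` between `x` and `x ^ (M + 1) / s` gives `s * (1 - log s) ≥ x ^ (M +
1) + s * (M * c + 1 - x)`, with equality at `s = x ^ M`. Cancelling `x ^ (M + 1)` and dividing by
`s` leaves a condition on the slope `K` free of `s`. -/
theorem affine_le_of_slope_le {x c K s : ℝ} {M : ℕ} (hx : 0 < x) (hc : c = -Real.log x)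
    (hc0 : 0 ≤ c) (hK : 0 ≤ K) (hs : x ^ (M + 1) ≤ s) (hs' : s ≤ x ^ M) (hxs : x * s ≤ x ^ (M + 1))
    (h : K * (c * (1 + 25 / 4 * (c * x ^ M))) ≤ M * c + (1 - x)) :
    x ^ (M + 1) + K * (c * s + 25 / 4 * (c * s) ^ 2) ≤ s * (1 - Real.log s) := by
  have hp : 0 < x ^ (M + 1) := by positivity
  have hs0 : 0 < s := hp.trans_le hs
  have h1 : K * (c * (1 + 25 / 4 * (c * s))) ≤ M * c + (1 - x) := by
    refine le_trans ?_ h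
    gcongr
  have h2 := log_sub_le_log_sub (q := x) (u := x ^ (M + 1) / s) hx
    ((le_div_iff₀ hs0).2 hxs) ((div_le_one hs0).2 hs)
  rw [Real.log_div hp.ne' hs0.ne', Real.log_pow] at h2
  have h3 : s * (x ^ (M + 1) / s) = x ^ (M + 1) := by field_simp
  have h4 := mul_le_mul_of_nonneg_left h1 hs0.le
  have h5 := mul_le_mul_of_nonneg_left h2 hs0.le
  push_cast at h5
  have h6 : Real.log x = -c := by rw [hc, neg_neg]
  rw [h6] at h5
  nlinarith

end Trade

section Slope

variable {x c : ℝ}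

theorem pow_eq_exp_neg (hx : 0 < x) (hc : c = -Real.log x) (M : ℕ) :
    x ^ M = Real.exp (-(M * c)) := by
  rw [hc, mul_neg, neg_neg, Real.exp_nat_mul, Real.exp_log hx]

theorem pow_mul_quadratic_le_one (hx : 0 < x) (hc : c = -Real.log x) (hc0 : 0 ≤ c) (M : ℕ) :
    x ^ M * (1 + M * c + (M * c) ^ 2 / 2) ≤ 1 := by
  have h := Real.quadratic_le_exp_of_nonneg (x := M * c) (by positivity)
  rw [pow_eq_exp_neg hx hc, Real.exp_neg, inv_mul_le_iff₀ (Real.exp_pos _)]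
  linarith

theorem mul_le_exp_neg_one (hx : 0 < x) (hc : c = -Real.log x) : x * c ≤ 0.368 := by
  have h := exp_neg_le_of_pow 1 1 (by norm_num) 0.368 (by norm_num) (by norm_num)
  have := neg_log_le_tangent hx 1 0.368 (by simpa using h)
  rw [hc]
  linarith

theorem cubic_le_neg_log {z : ℝ} (hz : 0 < z) (hz1 : z ≤ 1) :
    (1 - z) * (1 + (1 - z) / 2 + (1 - z) ^ 2 / 3) ≤ -Real.log z := by
  have h := Real.hasSum_pow_div_log_of_abs_lt_one (x := 1 - z)
    (by rw [abs_of_nonneg (by linarith)]; linarith)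
  rw [sub_sub_cancel] at h
  refine le_trans (le_of_eq ?_) (sum_le_hasSum (Finset.range 3) (fun i _ => ?_) h)
  · simp only [Finset.sum_range_succ, Finset.sum_range_zero]
    push_cast
    ring
  · have := sub_nonneg.2 hz1
    positivity

theorem slope_geom_aux {v w c : ℝ} (hv : 0 ≤ v) (hv1 : v ≤ 1) (hc : 0 ≤ c) (hcw : 2 * c ≤ w)
    (hw : v * (1 + v / 2 + v ^ 2 / 3) ≤ w) :
    v * (1 + 25 / 4 * (c * (1 - v))) ≤ w * (1 + c / 2) + 0.9 * c := by
  have hp : 1 ≤ v * (1 + v / 2 + v ^ 2 / 3) ^ 2 / 4 +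
      (1 + v / 2 + v ^ 2 / 3) * (1.45 - 3.125 * (v * (1 - v))) := by
    have := sub_nonneg.2 hv1
    nlinarith [mul_nonneg hv (sq_nonneg (v - 0.35)), mul_nonneg (mul_nonneg hv hv) hv,
      sq_nonneg (v - 0.35), mul_nonneg (mul_nonneg hv hv) (sq_nonneg (v - 0.35))]
  have hp0 : 0 ≤ v * (1 + v / 2 + v ^ 2 / 3) := by positivity
  have hvw : v ≤ w := by nlinarith [mul_nonneg hv hv, mul_nonneg (mul_nonneg hv hv) hv]
  have h1 : 0 ≤ 1.45 - 3.125 * (v * (1 - v)) := by nlinarith [sq_nonneg (v - 1 / 2)]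
  have h2 := mul_le_mul_of_nonneg_left hw h1
  have h3 := mul_self_le_mul_self hp0 hw
  have h4 := mul_le_mul_of_nonneg_left hp hv
  have h5 : v ≤ w ^ 2 / 4 + w * (1.45 - 3.125 * (v * (1 - v))) := by nlinarith
  rcases le_total (6.25 * (v * (1 - v)) - 0.9 - w / 2) 0 with h | h
  · nlinarith [mul_nonneg hc (neg_nonneg.2 h)]
  · nlinarith [mul_le_mul_of_nonneg_right hcw h]

/-- Multiplied by `1 - x`, the geometric sum becomes `1 - z` with `z = x ^ M`, and `M * c = -log z`.
So `M` enters only through `z` and the bounds `z ≤ x ^ 2` and `2 * c ≤ -log z`. -/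
theorem slope_geom (hx : 0 < x) (hx1 : x < 1) (hc : c = -Real.log x) (hc0 : 0 < c) {M : ℕ}
    (hM : 2 ≤ M) :
    (x * ∑ j ∈ Finset.range M, x ^ j) * (c * (1 + 25 / 4 * (c * x ^ M))) ≤ M * c + (1 - x) := by
  have hM' : (2 : ℝ) ≤ M := by exact_mod_cast hM
  have hgeom := mul_neg_geom_sum x M
  have hq1 := pow_mul_quadratic_le_one hx hc hc0.le 1
  have hq2 := pow_mul_quadratic_le_one hx hc hc0.le 2
  have hz2 : x ^ M ≤ x ^ 2 := pow_le_pow_of_le_one hx.le hx1.le hM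
  have hz0 : 0 < x ^ M := by positivity
  have hz1 : x ^ M ≤ 1 := pow_le_one₀ hx.le hx1.le
  have hw : (M : ℝ) * c = -Real.log (x ^ M) := by rw [Real.log_pow, hc]; ring
  have hwc : 2 * c ≤ M * c := by nlinarith
  generalize (∑ j ∈ Finset.range M, x ^ j) = S at *
  generalize x ^ M = z at *
  generalize (M : ℝ) * c = w at *
  norm_num at hq1 hq2
  have hα : 0 < 1 - x := by linarith
  rw [← mul_le_mul_iff_right₀ hα]
  have e : (1 - x) * (x * S * (c * (1 + 25 / 4 * (c * z)))) =
      (c * x) * ((1 - z) * (1 + 25 / 4 * (c * z))) := by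
    rw [← hgeom]; ring
  rw [e]
  have hg : c * x * (1 + c / 2) ≤ 1 - x := by nlinarith
  have hv : 0 ≤ 1 - z := by linarith
  have hP : 0 ≤ (1 - z) * (1 + 25 / 4 * (c * z)) := by positivity
  -- For `c ≥ 1` the correction `25/4 * c * z` is small because `z ≤ x ^ 2`. For `c ≤ 1` a cubic
  -- Taylor bound for `-log z` is needed, supplied through `slope_geom_aux` with `v = 1 - z`.
  rcases le_total 1 c with h1 | h1
  · have h2 : c * z ≤ 0.2 := by
      have : c * x ^ 2 ≤ 0.2 := by
        have : 5 * c * x ^ 2 ≤ x ^ 2 * (1 + 2 * c + (2 * c) ^ 2 / 2) := by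
          nlinarith [mul_nonneg (sq_nonneg x) (mul_nonneg (sub_nonneg.2 h1) hc0.le),
            mul_nonneg (sq_nonneg x) (mul_nonneg (sub_nonneg.2 h1) (sub_nonneg.2 h1))]
        linarith
      nlinarith
    have h3 : c * x ≤ 2 / 3 * (1 - x) := by nlinarith [mul_pos hc0 hx]
    have h4 : (1 - z) * (1 + 25 / 4 * (c * z)) ≤ 2.25 := by nlinarith [mul_pos hc0 hz0]
    nlinarith [mul_pos hc0 hx]
  · have hα2 : 0.9 * c ≤ (1 - x) * (1 + c / 2) := by
      have h5 : x * (1 + c + c ^ 2 / 2) * (1 + c / 2) ≤ 1 + c / 2 := by nlinarith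
      have h6 : 0 < 1 + c + c ^ 2 / 2 := by positivity
      rw [← mul_le_mul_iff_right₀ h6]
      nlinarith [mul_nonneg hc0.le (mul_nonneg hc0.le (sub_nonneg.2 h1))]
    have key : (1 - z) * (1 + 25 / 4 * (c * z)) ≤ w * (1 + c / 2) + 0.9 * c := by
      have h9 := slope_geom_aux hv (by linarith) hc0.le hwc (hw ▸ cubic_le_neg_log hz0 hz1)
      rwa [sub_sub_cancel] at h9
    have h7 : (1 - z) * (1 + 25 / 4 * (c * z)) ≤ (w + (1 - x)) * (1 + c / 2) := by linarith
    have h8 : 0 < 1 + c / 2 := by positivity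
    rw [← mul_le_mul_iff_left₀ h8]
    nlinarith [mul_pos hc0 hx]

theorem slope_half (hx : 0 < x) (hx1 : x < 1) (hc : c = -Real.log x) (hc0 : 0 < c) {M : ℕ}
    (hM : 2 ≤ M) :
    (M * (1 / 2)) * (c * (1 + 25 / 4 * (c * x ^ M))) ≤ M * c + (1 - x) := by
  have hq1 := pow_mul_quadratic_le_one hx hc hc0.le 1
  -- For `M ≥ 3` the correction `25/4 * c * x ^ M` is at most `1`. This can fail for `M = 2`, where
  -- the term `1 - x` is needed as well.
  rcases hM.eq_or_lt with rfl | hM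
  · have hq2 := pow_mul_quadratic_le_one hx hc hc0.le 2
    norm_num at hq1 hq2
    have hQ : 0 < 1 + c + c ^ 2 / 2 := by positivity
    have hα : c * (1 + c / 2) / (1 + c + c ^ 2 / 2) ≤ 1 - x := by
      rw [div_le_iff₀ hQ]; linarith
    have hR : 0 < 1 + 2 * c + (2 * c) ^ 2 / 2 := by positivity
    have h2 : x ^ 2 ≤ 1 / (1 + 2 * c + (2 * c) ^ 2 / 2) := by rw [le_div_iff₀ hR]; exact hq2
    have h3 : 25 / 4 * (c ^ 2 * (1 / (1 + 2 * c + (2 * c) ^ 2 / 2))) ≤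
        c + c * (1 + c / 2) / (1 + c + c ^ 2 / 2) := by
      rw [← sub_nonneg]
      have : c + c * (1 + c / 2) / (1 + c + c ^ 2 / 2) -
          25 / 4 * (c ^ 2 * (1 / (1 + 2 * c + (2 * c) ^ 2 / 2))) =
          c * (2 - 3 / 4 * c + 5 / 4 * c ^ 2 + 7 / 8 * c ^ 3 + c ^ 4) /
            ((1 + c + c ^ 2 / 2) * (1 + 2 * c + (2 * c) ^ 2 / 2)) := by
        field_simp
        ring
      rw [this]
      have : 0 ≤ 2 - 3 / 4 * c + 5 / 4 * c ^ 2 := by nlinarith [sq_nonneg (c - 1)]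
      positivity
    have h4 := mul_le_mul_of_nonneg_left h2 (sq_nonneg c)
    push_cast
    nlinarith
  · have hq3 := pow_mul_quadratic_le_one hx hc hc0.le 3
    have hz : x ^ M ≤ x ^ 3 := pow_le_pow_of_le_one hx.le hx1.le hM
    have hM0 : (0 : ℝ) ≤ M := by positivity
    have h1 : 25 / 4 * (c * x ^ 3) ≤ 1 := by
      refine le_trans ?_ hq3
      push_cast
      nlinarith [mul_nonneg (pow_pos hx 3).le (sq_nonneg (c - 0.36)), pow_pos hx 3]
    have h2 : 25 / 4 * (c * x ^ M) ≤ 1 := by nlinarith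
    nlinarith [mul_nonneg (mul_nonneg hM0 hc0.le) (sub_nonneg.2 h2)]

theorem slope_coverage (hx : 0 < x) (hx1 : x < 1) (hc : c = -Real.log x) (hc0 : 0 < c) {M : ℕ}
    (hM : 2 ≤ M) :
    (M * (1 - x)) * (c * (1 + 25 / 4 * (c * x ^ M))) ≤ M * c + (1 - x) := by
  have hα : 0 < 1 - x := by linarith
  rcases hM.eq_or_lt with rfl | hM
  · have hy := mul_le_exp_neg_one hx hc
    have hy0 : 0 < x * c := by positivity
    have h1 : 12.5 * (x * c) ^ 2 ≤ 1 + 2 * (x * c) := by nlinarith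
    push_cast
    nlinarith [mul_le_mul_of_nonneg_left h1 hα.le]
  · have hz : x ^ M ≤ x ^ 3 := pow_le_pow_of_le_one hx.le hx1.le hM
    have hM0 : (0 : ℝ) ≤ M := by positivity
    have hc2 := neg_log_le_half hx hx1.le
    rw [← hc, le_div_iff₀ (by positivity)] at hc2
    have h1 : 25 / 4 * ((1 - x) * (c * x ^ 3)) ≤ x := by
      have : (1 - x) * (c * x ^ 3) * 2 ≤ (1 - x) * (x ^ 2 * (1 - x ^ 2)) := by
        nlinarith [mul_le_mul_of_nonneg_left hc2 (by positivity : 0 ≤ (1 - x) * x ^ 2)]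
      have h3 : 25 / 8 * ((1 - x) * (x * (1 - x ^ 2))) ≤ 1 := by
        nlinarith [sq_nonneg (x - 0.4), mul_pos hx hα, sq_nonneg (x ^ 2 - x)]
      nlinarith
    have h2 : 25 / 4 * ((1 - x) * (c * x ^ M)) ≤ x := by
      refine le_trans ?_ h1
      gcongr
    nlinarith [mul_nonneg (mul_nonneg hM0 hc0.le) (sub_nonneg.2 h2)]

end Slope

/-! ### The case of two candidates, and the affine bound in general. -/

section AffineBound

variable {x c s : ℝ}

theorem mul_cubic_le_one (hx : 0 < x) (hc : c = -Real.log x) (hc0 : 0 ≤ c) :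
    x * (1 + c + c ^ 2 / 2 + c ^ 3 / 6) ≤ 1 := by
  have h := Real.sum_le_exp_of_nonneg hc0 4
  have hx' : x = Real.exp (-c) := by rw [hc, neg_neg, Real.exp_log hx]
  rw [hx', Real.exp_neg, inv_mul_le_iff₀ (Real.exp_pos _)]
  norm_num [Finset.sum_range_succ, Nat.factorial] at h
  linarith

theorem slope_one (hx : 0 < x) (hc : c = -Real.log x) (hc0 : 0 < c) :
    x * (c * (1 + 25 / 4 * (c * x ^ 1))) ≤ (1 : ℕ) * c + (1 - x) := by
  have h := mul_cubic_le_one hx hc hc0.le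
  have h1 : 25 / 4 * c ≤ (1 + c + c ^ 2 / 2 + c ^ 3 / 6) * ((1 + c) * (1 + c / 2 + c ^ 2 / 6)) := by
    nlinarith [sq_nonneg (c - 0.45), mul_nonneg hc0.le (sq_nonneg (c - 0.45)),
      sq_nonneg (c ^ 2 - 0.45 ^ 2), pow_pos hc0 5, pow_pos hc0 6, pow_pos hc0 3]
  have hR : 0 ≤ (1 + c) * (1 + c / 2 + c ^ 2 / 6) := by positivity
  have h2 : 25 / 4 * (c * x) ≤ (1 + c) * (1 + c / 2 + c ^ 2 / 6) := by
    nlinarith [mul_le_mul_of_nonneg_left h1 hx.le, mul_le_mul_of_nonneg_right h hR]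
  have h3 : x * c * (1 + c / 2 + c ^ 2 / 6) ≤ 1 - x := by nlinarith
  have h4 := mul_le_mul_of_nonneg_left h2 (mul_pos hx hc0).le
  have h5 := mul_le_mul_of_nonneg_left h3 (by positivity : 0 ≤ 1 + c)
  push_cast
  nlinarith

/-- Here the worst case is `s = x / 2`, which improves the lower bound for `-log s` by `log 2`. The
term `c ^ 2 * x` is controlled by `-y log y ≤ 1/e` at `y = √x`. -/
theorem log_two_slope (hx : 0 < x) (hx2 : x ≤ 1 / 2) (hc : c = -Real.log x) (hs0 : 0 < s)
    (hs : x ^ 2 ≤ s) (hsx : s ≤ x / 2) :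
    x ^ 2 + (1 - x) * (c * s + 25 / 4 * (c * s) ^ 2) ≤ s * (1 - Real.log s) := by
  have hl := Real.log_two_gt_d9
  have hx' : Real.log x = -c := by rw [hc, neg_neg]
  have hcl : 0.69 ≤ c := by
    have := Real.log_le_log hx hx2
    rw [one_div, Real.log_inv] at this
    linarith
  have h1 := log_sub_le_log_sub (q := 2 * x) (u := x ^ 2 / s) (by positivity)
    ((le_div_iff₀ hs0).2 (by nlinarith)) ((div_le_one hs0).2 hs)
  rw [Real.log_div (by positivity) hs0.ne', Real.log_pow, Real.log_mul two_ne_zero hx.ne',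
    hx'] at h1
  push_cast at h1
  have h3 : s * (x ^ 2 / s) = x ^ 2 := by field_simp
  have h4 : s * (Real.log 2 + c - 2 * x) ≤ -s * Real.log s - x ^ 2 := by nlinarith
  have h5 := mul_le_exp_neg_one (x := √x) (c := c / 2) (by positivity)
    (by rw [Real.log_sqrt hx.le, hc]; ring)
  have h6 : c ^ 2 * x ≤ 4 * 0.368 ^ 2 := by
    have h7 : (√x * (c / 2)) ^ 2 ≤ 0.368 ^ 2 := by gcongr
    rw [mul_pow, Real.sq_sqrt hx.le] at h7
    linarith
  have h8 : (1 - x) * (c * (1 + 25 / 4 * (c * s))) ≤ 1 + (Real.log 2 + c - 2 * x) := by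
    have h9 : c ^ 2 * s ≤ c ^ 2 * x / 2 := by nlinarith [sq_nonneg c]
    have h10 : (1 - x) * (25 / 4 * (c ^ 2 * s)) ≤ (1 - x) * 1.6928 := by
      gcongr
      · linarith
      · linarith
    nlinarith
  nlinarith [mul_le_mul_of_nonneg_left h8 hs0.le]

/-- With `s = τ * x` and `log τ ≤ τ - 1`, the gap is bounded below by a concave quadratic in `τ`. It
therefore suffices to check `τ = 1` and `τ = 1/2`, the facts `one` and `half`. -/
theorem half_slope (hx : 0 < x) (hx2 : x ≤ 1 / 2) (hc : c = -Real.log x)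
    (hsx : x / 2 ≤ s) (hs : s ≤ x) :
    (1 - x) * x + x * (c * s + 25 / 4 * (c * s) ^ 2) ≤ s * (1 - Real.log s) := by
  have hl := Real.log_two_gt_d9
  have hx' : Real.log x = -c := by rw [hc, neg_neg]
  have hcl : 0.6931 ≤ c := by
    have := Real.log_le_log hx hx2
    rw [one_div, Real.log_inv] at this
    linarith
  have hxc : (1.6931 - c) / 2 ≤ x := by
    have h := Real.add_one_le_exp (Real.log 2 - c)
    have h2 : Real.exp (Real.log 2 - c) = 2 * x := by
      rw [sub_eq_add_neg, ← hx', Real.exp_add, Real.exp_log two_pos, Real.exp_log hx]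
    linarith
  have hy := mul_le_exp_neg_one hx hc
  obtain ⟨τ, rfl⟩ : ∃ τ, s = τ * x := ⟨s / x, by field_simp⟩
  have hτ : 1 / 2 ≤ τ := by nlinarith
  have hτ1 : τ ≤ 1 := by nlinarith
  have hτ0 : 0 < τ := by linarith
  have hlog := Real.log_le_sub_one_of_pos hτ0
  rw [Real.log_mul hτ0.ne' hx.ne', hx']
  have hy0 : 0 < x * c := by positivity
  have one : 25 / 4 * (x * c) ^ 2 ≤ x + (1 - x) * c := by
    rcases le_total 0.78 c with h | h
    · nlinarith
    · have hP := mul_cubic_le_one hx hc (by linarith)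
      have hy2 : x * c ≤ 0.361 := by
        have : c ≤ 0.361 * (1 + c + c ^ 2 / 2 + c ^ 3 / 6) := by
          nlinarith [mul_nonneg (sub_nonneg.2 hcl) (sub_nonneg.2 h), sq_nonneg (c - 0.78),
            mul_nonneg (mul_nonneg (sub_nonneg.2 hcl) (sub_nonneg.2 h)) (sub_nonneg.2 h)]
        nlinarith
      nlinarith
  have half : (1 - x) + 25 / 16 * (x * c) ^ 2 ≤ (1 - x) * c / 2 + 3 / 4 := by
    have h1 : (x * c) ^ 2 ≤ 0.368 ^ 2 := by gcongr
    rcases le_total c 2 with h | h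
    · nlinarith [sq_nonneg (c - 0.8465)]
    · nlinarith
  have h : (1 - x) + 25 / 4 * (x * c) ^ 2 * τ ^ 2 ≤ τ * ((1 - x) * c) + 2 * τ - τ ^ 2 := by
    nlinarith [mul_nonneg (sub_nonneg.2 hτ) (sub_nonneg.2 hτ1), mul_nonneg (sub_nonneg.2 hτ) (sub_nonneg.2 one), mul_nonneg (sub_nonneg.2 hτ1) (sub_nonneg.2 half), mul_nonneg (sq_nonneg (x * c)) (mul_nonneg (sub_nonneg.2 hτ) (sub_nonneg.2 hτ1))]
  nlinarith [mul_le_mul_of_nonneg_left h hx.le, mul_le_mul_of_nonneg_left hlog (mul_pos hτ0 hx).le]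

/-- For `M ≥ 2` the slope is the larger of the coefficients of `a` and `b` in `failureProb_le`. For
`M = 1` and `x ≤ 1/2` the coefficient `1 - x` of `a` is the larger one and is too costly when `s` is
close to `x`. There `a ≤ x` trades the slope down to `x` at the price of raising the constant to `(1
- x) * x`. -/
theorem exists_affine_bound {M : ℕ} (hM : 1 ≤ M) (hx : 0 < x) (hx1 : x < 1)
    (hc : c = -Real.log x) (hs : x ^ (M + 1) ≤ s) (hs' : s ≤ x ^ M) :
    ∃ A B : ℝ, 0 ≤ B ∧
      (∀ a u b : ℝ, 0 ≤ a → 0 ≤ u → 0 ≤ b → a + u ≤ x → a + u + b ≤ 1 →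
        failureProb M a u b ≤ A + B * (a + b)) ∧
      A + B * (c * s + 25 / 4 * (c * s) ^ 2) ≤ s * (1 - Real.log s) := by
  have hc0 : 0 < c := by
    rw [hc]
    exact neg_pos.2 (Real.log_neg hx hx1)
  have hs0 : 0 < s := lt_of_lt_of_le (by positivity) hs
  have hxs : x * s ≤ x ^ (M + 1) := by
    rw [pow_succ']
    gcongr
  have hS : 0 ≤ x * ∑ j ∈ Finset.range M, x ^ j :=
    mul_nonneg hx.le (Finset.sum_nonneg fun _ _ => by positivity)
  rcases hM.eq_or_lt with rfl | hM
  · have hf : ∀ a u b : ℝ, 0 ≤ a → 0 ≤ u → 0 ≤ b → a + u ≤ x → a + u + b ≤ 1 →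
        failureProb 1 a u b ≤ x ^ 2 + x * b + (1 - x) * a := by
      intro a u b ha hu hb hau h1
      obtain ⟨b', -, hb', -, h⟩ := failureProb_le (M := 1) (K := 1 - x) ha hu hb hx1.le hau h1
        (fun y _ _ => by norm_num)
      rw [Finset.sum_range_one, pow_zero, mul_one] at h
      have := mul_le_mul_of_nonneg_left hb' hx.le
      norm_num at h
      linarith
    rw [pow_one] at hs'
    rcases le_total x (1 / 2) with hx2 | hx2
    · rcases le_total s (x / 2) with hsx | hsx
      · refine ⟨x ^ 2, 1 - x, by linarith, fun a u b ha hu hb hau h1 => ?_,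
          log_two_slope hx hx2 hc hs0 hs hsx⟩
        nlinarith [hf a u b ha hu hb hau h1]
      · refine ⟨(1 - x) * x, x, hx.le, fun a u b ha hu hb hau h1 => ?_,
          half_slope hx hx2 hc hsx hs'⟩
        nlinarith [hf a u b ha hu hb hau h1]
    · refine ⟨x ^ 2, x, hx.le, fun a u b ha hu hb hau h1 => ?_,
        affine_le_of_slope_le hx hc hc0.le hx.le hs (by simpa using hs') hxs (slope_one hx hc hc0)⟩
      nlinarith [hf a u b ha hu hb hau h1]
  · refine ⟨x ^ (M + 1), max (x * ∑ j ∈ Finset.range M, x ^ j) (M * max (1 / 2) (1 - x)),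
      le_max_of_le_left hS, fun a u b ha hu hb hau h1 => ?_,
      affine_le_of_slope_le hx hc hc0.le (le_max_of_le_left hS) hs hs' hxs ?_⟩
    · obtain ⟨b', hb0, hb', -, h⟩ := failureProb_le ha hu hb hx1.le hau h1
        (fun y h0 h1 => geom_sum_le_max (x := x) h0 h1 M)
      refine h.trans ?_
      rw [add_assoc, mul_add, add_comm (_ * a) (_ * b)]
      gcongr
      exacts [le_max_left _ _, le_max_right _ _]
    · rcases max_cases (x * ∑ j ∈ Finset.range M, x ^ j) (M * max (1 / 2) (1 - x)) with
        ⟨h, _⟩ | ⟨h, _⟩ <;> rw [h]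
      · exact slope_geom hx hx1 hc hc0 hM
      · rcases max_cases (1 / 2 : ℝ) (1 - x) with ⟨h, _⟩ | ⟨h, _⟩ <;> rw [h]
        · exact slope_half hx hx1 hc hc0 hM
        · exact slope_coverage hx hx1 hc hc0 hM

end AffineBound

/-! ### Exact evaluation of the Best-of-N failure probability. -/

section Grouping

variable {Y : Type*} [Fintype Y] (flag : Y → Bool) (w bad : Y → ℝ)

/-- The indices of the flagged candidates. -/
def flagged {N : ℕ} (ys : Fin N → Y) : Finset (Fin N) :=
  Finset.univ.filter fun i => flag (ys i) = true

/-- Prescribing the flagged positions confines each candidate separately, so the fibre is a product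
set and the sum factorizes. -/
theorem sum_flagged_eq {N : ℕ} [DecidableEq (Fin N → Y)] (S : Finset (Fin N)) (j : Fin N) :
    ∑ ys : Fin N → Y with flagged flag ys = S, (∏ i, w (ys i)) * bad (ys j) =
      (∑ y with flag y = decide (j ∈ S), w y * bad y) *
        ∏ i ∈ Finset.univ.erase j, ∑ y with flag y = decide (i ∈ S), w y := by
  classical
  have h1 : (Finset.univ.filter fun ys : Fin N → Y => flagged flag ys = S) =
      Fintype.piFinset fun i => Finset.univ.filter fun y => flag y = decide (i ∈ S) := by
    ext ys
    simp only [flagged, Finset.ext_iff, Finset.mem_filter, Finset.mem_univ, true_and,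
      Fintype.mem_piFinset]
    refine forall_congr' fun i => ?_
    by_cases h : i ∈ S <;> simp [h]
  have h2 : ∀ ys : Fin N → Y, (∏ i, w (ys i)) * bad (ys j) =
      ∏ i, (w (ys i) * if i = j then bad (ys i) else 1) := by
    intro ys
    rw [Finset.prod_mul_distrib, Finset.prod_ite_eq' Finset.univ j (fun i => bad (ys i)),
      if_pos (Finset.mem_univ j)]
  simp_rw [h1, h2]
  rw [← Finset.prod_univ_sum (fun i => Finset.univ.filter fun y => flag y = decide (i ∈ S))
      (fun i y => w y * if i = j then bad y else 1),
    ← Finset.mul_prod_erase _ _ (Finset.mem_univ j)]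
  simp only [if_true]
  congr 1
  refine Finset.prod_congr rfl fun i hi => ?_
  simp [Finset.ne_of_mem_erase hi]

/-- The average of `bad` over the flagged candidates, or over all the candidates if none is flagged,
has expectation `failureProb`. -/
theorem sum_average_flagged_eq {M : ℕ} {a u q y : ℝ} (hq : q = ∑ z with flag z = true, w z)
    (hy : y = ∑ z with flag z = false, w z) (hqy : q + y = 1)
    (ha : a = ∑ z with flag z = true, w z * bad z)
    (hu : u = ∑ z with flag z = false, w z * bad z) (haq : q = 0 → a = 0)
    (B : (Fin (M + 1) → Y) → Finset (Fin (M + 1)))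
    (hB : ∀ ys, B ys = if (flagged flag ys).Nonempty then flagged flag ys else Finset.univ) :
    ∑ ys : Fin (M + 1) → Y, (∏ i, w (ys i)) * (((B ys).card : ℝ)⁻¹ * ∑ j ∈ B ys, bad (ys j)) =
      y ^ M * u + a * ∑ j ∈ Finset.range (M + 1), y ^ j := by
  classical
  have hprod : ∀ S : Finset (Fin (M + 1)),
      ∏ i, (∑ z with flag z = decide (i ∈ S), w z) = q ^ S.card * y ^ (M + 1 - S.card) := by
    intro S
    have : ∀ i, (∑ z with flag z = decide (i ∈ S), w z) = if i ∈ S then q else y := by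
      intro i
      by_cases h : i ∈ S <;> simp [h, hq, hy]
    simp_rw [this]
    rw [Finset.prod_ite, Finset.prod_const, Finset.prod_const, Finset.filter_mem_eq_inter,
      Finset.univ_inter, Finset.filter_not, Finset.filter_mem_eq_inter, Finset.univ_inter,
      ← Finset.compl_eq_univ_sdiff, Finset.card_compl, Fintype.card_fin]
  -- Given the flagged set `S`, each chosen index in `S` is bad with conditional probability `a /
  -- q`, so averaging over `S` changes nothing. If `q = 0` then `a = 0`, and the value of `a / q` is
  -- harmless.
  have hterm : ∀ S : Finset (Fin (M + 1)), S.Nonempty →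
      ∑ ys : Fin (M + 1) → Y with flagged flag ys = S,
        (∏ i, w (ys i)) * (((B ys).card : ℝ)⁻¹ * ∑ j ∈ B ys, bad (ys j)) =
      a / q * (q ^ S.card * y ^ (M + 1 - S.card)) := by
    intro S hS
    have h1 : ∀ j ∈ S, ∑ ys : Fin (M + 1) → Y with flagged flag ys = S,
        (∏ i, w (ys i)) * bad (ys j) = a / q * (q ^ S.card * y ^ (M + 1 - S.card)) := by
      intro j hj
      rw [sum_flagged_eq, ← hprod S, ← Finset.mul_prod_erase _ _ (Finset.mem_univ j)]
      simp only [hj, decide_true]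
      rw [← ha, ← hq]
      by_cases h0 : q = 0
      · simp [haq h0]
      · field_simp
    calc _ = ∑ ys : Fin (M + 1) → Y with flagged flag ys = S,
          (S.card : ℝ)⁻¹ * ∑ j ∈ S, (∏ i, w (ys i)) * bad (ys j) := by
          refine Finset.sum_congr rfl fun ys hys => ?_
          rw [Finset.mem_filter] at hys
          rw [hB ys, hys.2, if_pos hS, Finset.mul_sum, Finset.mul_sum, Finset.mul_sum]
          exact Finset.sum_congr rfl fun _ _ => by ring
      _ = _ := by
          rw [← Finset.mul_sum, Finset.sum_comm, Finset.sum_congr rfl h1, Finset.sum_const,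
            nsmul_eq_mul, inv_mul_cancel_left₀]
          exact_mod_cast hS.card_pos.ne'
  have hempty : ∑ ys : Fin (M + 1) → Y with flagged flag ys = ∅,
        (∏ i, w (ys i)) * (((B ys).card : ℝ)⁻¹ * ∑ j ∈ B ys, bad (ys j)) = y ^ M * u := by
    have h1 : ∀ j : Fin (M + 1), ∑ ys : Fin (M + 1) → Y with flagged flag ys = ∅,
        (∏ i, w (ys i)) * bad (ys j) = y ^ M * u := by
      intro j
      rw [sum_flagged_eq]
      simp [← hy, ← hu, mul_comm]
    calc _ = ∑ ys : Fin (M + 1) → Y with flagged flag ys = ∅,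
          ((M + 1 : ℕ) : ℝ)⁻¹ * ∑ j, (∏ i, w (ys i)) * bad (ys j) := by
          refine Finset.sum_congr rfl fun ys hys => ?_
          rw [Finset.mem_filter] at hys
          rw [hB ys, hys.2, if_neg Finset.not_nonempty_empty, Finset.card_univ, Fintype.card_fin,
            Finset.mul_sum, Finset.mul_sum, Finset.mul_sum]
          exact Finset.sum_congr rfl fun _ _ => by ring
      _ = _ := by
          rw [← Finset.mul_sum, Finset.sum_comm, Finset.sum_congr rfl fun j _ => h1 j,
            Finset.sum_const, nsmul_eq_mul, Finset.card_univ, Fintype.card_fin,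
            inv_mul_cancel_left₀]
          positivity
  rw [← Finset.sum_fiberwise _ (fun ys => flagged flag ys),
    ← Finset.add_sum_erase _ _ (Finset.mem_univ ∅), hempty]
  congr 1
  -- By the binomial theorem the nonempty flagged sets have total mass `1 - y ^ (M + 1)`; divided by
  -- `q = 1 - y` this is the geometric sum.
  have hpow := Fintype.sum_pow_mul_eq_add_pow (Fin (M + 1)) q y
  rw [hqy, one_pow, Fintype.card_fin, ← Finset.add_sum_erase _ _ (Finset.mem_univ ∅),
    Finset.card_empty, pow_zero, one_mul, Nat.sub_zero] at hpow
  rw [Finset.sum_congr rfl fun S hS => hterm S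
    (Finset.nonempty_iff_ne_empty.2 (Finset.ne_of_mem_erase hS)), ← Finset.mul_sum]
  have hgeom := mul_neg_geom_sum y (M + 1)
  have hq' : q = 1 - y := by linarith
  by_cases h0 : q = 0
  · simp [haq h0]
  · rw [← mul_div_right_comm, div_eq_iff h0, mul_assoc]
    congr 1
    rw [mul_comm, hq', hgeom, ← hq']
    linarith

end Grouping

namespace BestOfN

/-- Scores are binary: the maximizers are the candidates scoring one, or all candidates if none
does. -/
theorem best_eq {T N : ℕ} (ρ : Reward T) (x : Prompt) (ys : Fin N → Response T) :
    best ρ x ys = if (flagged (fun y => ρ (x, y)) ys).Nonempty then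
      flagged (fun y => ρ (x, y)) ys else Finset.univ := by
  ext j
  split_ifs with h
  · obtain ⟨k, hk⟩ := h
    simp only [flagged, best, Finset.mem_filter, Finset.mem_univ, true_and] at hk ⊢
    constructor
    · intro hj
      have := hj k
      rw [hk] at this
      exact top_le_iff.1 this
    · intro hj k
      rw [hj]
      exact le_top
  · rw [Finset.not_nonempty_iff_eq_empty, flagged, Finset.filter_eq_empty_iff] at h
    simp only [best, Finset.mem_filter, Finset.mem_univ, true_and, iff_true]
    intro k
    have := h (Finset.mem_univ k)
    simp only [Bool.not_eq_true] at this
    rw [this]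
    exact bot_le

section Expect

variable {α β : Type*}

theorem expect_eq_sum [Fintype α] (p : PMF α) (f : α → ℝ) :
    expect p f = ∑ a, (p a).toReal * f a := tsum_fintype _

theorem expect_bind [Fintype α] [Fintype β] (p : PMF α) (g : α → PMF β) (f : β → ℝ) :
    expect (p.bind g) f = expect p fun a => expect (g a) f := by
  simp only [expect_eq_sum, PMF.bind_apply, tsum_fintype]
  simp_rw [ENNReal.toReal_sum fun a _ => ENNReal.mul_ne_top (p.apply_ne_top a)
    ((g a).apply_ne_top _), ENNReal.toReal_mul, Finset.mul_sum, Finset.sum_mul]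
  rw [Finset.sum_comm]
  simp_rw [mul_assoc]

theorem expect_pure [Fintype α] (a : α) (f : α → ℝ) : expect (PMF.pure a) f = f a := by
  classical
  rw [expect_eq_sum, Finset.sum_eq_single a] <;> simp +contextual [PMF.pure_apply]

theorem expect_map [Fintype α] [Fintype β] (p : PMF α) (g : α → β) (f : β → ℝ) :
    expect (p.map g) f = expect p fun a => f (g a) := by
  rw [← PMF.bind_pure_comp, expect_bind]
  simp [expect_pure]

theorem expect_uniformOfFinset [Fintype α] (s : Finset α) (hs : s.Nonempty) (f : α → ℝ) :
    expect (PMF.uniformOfFinset s hs) f = (s.card : ℝ)⁻¹ * ∑ a ∈ s, f a := by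
  classical
  rw [expect_eq_sum, Finset.mul_sum, ← Finset.sum_subset (Finset.subset_univ s)]
  · refine Finset.sum_congr rfl fun a ha => ?_
    rw [PMF.uniformOfFinset_apply_of_mem hs ha, ENNReal.toReal_inv, ENNReal.toReal_natCast]
  · intro a _ ha
    rw [PMF.uniformOfFinset_apply_of_notMem hs ha, ENNReal.toReal_zero, zero_mul]

theorem sum_toReal [Fintype α] (p : PMF α) : ∑ a, (p a).toReal = 1 := by
  rw [← ENNReal.toReal_sum fun a _ => p.apply_ne_top a, ← tsum_fintype (L := .unconditional α),
    p.tsum_coe, ENNReal.toReal_one]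

end Expect

/-- The probability that a response to `x` is misjudged. -/
noncomputable def misjudged {T : ℕ} (π₀ : Prompt → PMF (Response T)) (rstar ρ : Reward T) (x : Prompt) : ℝ :=
  expect (π₀ x) fun y => ind (rstar (x, y) ≠ ρ (x, y))

theorem exists_failureProb {T : ℕ} (π₀ : Prompt → PMF (Response T)) (rstar ρ : Reward T)
    (M : ℕ) (x : Prompt) :
    ∃ a u b : ℝ, 0 ≤ a ∧ 0 ≤ u ∧ 0 ≤ b ∧ a + u = 1 - coverage π₀ rstar x ∧ a + u + b ≤ 1 ∧
      misjudged π₀ rstar ρ x = a + b ∧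
      expect (bonPolicy π₀ ρ (M + 1) x) (fun y => ind (rstar (x, y) = true)) =
        1 - failureProb M a u b := by
  classical
  obtain ⟨w, hw⟩ : ∃ w : Response T → ℝ, w = fun y => (π₀ x y).toReal := ⟨_, rfl⟩
  obtain ⟨flag, hflag⟩ : ∃ flag : Response T → Bool, flag = fun y => ρ (x, y) := ⟨_, rfl⟩
  obtain ⟨bad, hbad⟩ : ∃ bad : Response T → ℝ, bad = fun y => ind (rstar (x, y) = false) :=
    ⟨_, rfl⟩
  have hw0 : ∀ y, 0 ≤ w y := fun y => by rw [hw]; exact ENNReal.toReal_nonneg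
  have hb0 : ∀ y, 0 ≤ bad y := fun y => by rw [hbad]; simp only [ind]; split_ifs <;> simp
  have hb1 : ∀ y, bad y ≤ 1 := fun y => by rw [hbad]; simp only [ind]; split_ifs <;> simp
  have hgood : ∀ y, ind (rstar (x, y) = true) = 1 - bad y := fun y => by
    rw [hbad]
    cases h : rstar (x, y) <;> simp [ind, h]
  have hmis : ∀ y, ind (rstar (x, y) ≠ ρ (x, y)) =
      if flag y = true then bad y else 1 - bad y := fun y => by
    rw [hbad, hflag]
    cases h : rstar (x, y) <;> cases h' : ρ (x, y) <;> simp [ind, h, h']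
  have hw1 : ∑ y, w y = 1 := by rw [hw]; exact sum_toReal _
  have hsplit : ∀ f : Response T → ℝ,
      ∑ y with flag y = true, f y + ∑ y with flag y = false, f y = ∑ y, f y := fun f => by
    simpa using Finset.sum_filter_add_sum_filter_not Finset.univ (fun y => flag y = true) f
  obtain ⟨a, ha⟩ : ∃ a, a = ∑ y with flag y = true, w y * bad y := ⟨_, rfl⟩
  obtain ⟨u, hu⟩ : ∃ u, u = ∑ y with flag y = false, w y * bad y := ⟨_, rfl⟩
  obtain ⟨b, hb⟩ : ∃ b, b = ∑ y with flag y = false, w y * (1 - bad y) := ⟨_, rfl⟩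
  obtain ⟨q, hq⟩ : ∃ q, q = ∑ y with flag y = true, w y := ⟨_, rfl⟩
  have hub : u + b = ∑ y with flag y = false, w y := by
    rw [hu, hb, ← Finset.sum_add_distrib]
    exact Finset.sum_congr rfl fun _ _ => by ring
  have hqub : q + (u + b) = 1 := by rw [hub, hq, hsplit, hw1]
  have haq : a ≤ q := by
    rw [ha, hq]
    exact Finset.sum_le_sum fun y _ => mul_le_of_le_one_right (hw0 y) (hb1 y)
  have ha0 : 0 ≤ a := by
    rw [ha]
    exact Finset.sum_nonneg fun y _ => mul_nonneg (hw0 y) (hb0 y)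
  refine ⟨a, u, b, ha0, ?_, ?_, ?_, by linarith, ?_, ?_⟩
  · rw [hu]
    exact Finset.sum_nonneg fun y _ => mul_nonneg (hw0 y) (hb0 y)
  · rw [hb]
    exact Finset.sum_nonneg fun y _ => mul_nonneg (hw0 y) (sub_nonneg.2 (hb1 y))
  · rw [ha, hu, hsplit, coverage, expect_eq_sum]
    simp_rw [hgood, mul_sub, mul_one]
    rw [Finset.sum_sub_distrib, sum_toReal, sub_sub_cancel, hw]
  · rw [misjudged, expect_eq_sum, ha, hb, ← hsplit]
    congr 1 <;> refine Finset.sum_congr rfl fun y hy => ?_ <;> rw [Finset.mem_filter] at hy <;>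
      simp [hmis, hy.2, hw]
  · have h := sum_average_flagged_eq (M := M) flag w bad hq hub hqub ha hu (fun h => by linarith)
      (best ρ x) (fun ys => by rw [hflag]; exact best_eq ρ x ys)
    have hiid : ∑ ys : Fin (M + 1) → Response T, ∏ i, w (ys i) = 1 := by
      rw [← sum_toReal (iid (π₀ x) (M + 1))]
      simp_rw [iid_apply, ENNReal.toReal_prod, hw]
    rw [failureProb, ← h, ← hiid, ← Finset.sum_sub_distrib, bonPolicy, expect_bind, expect_eq_sum]
    refine Finset.sum_congr rfl fun ys _ => ?_
    have hcard : ((best ρ x ys).card : ℝ) ≠ 0 := by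
      exact_mod_cast (best_nonempty ρ x ys).card_pos.ne'
    rw [iid_apply, ENNReal.toReal_prod, expect_map, expect_uniformOfFinset]
    simp_rw [hgood]
    rw [Finset.sum_sub_distrib, Finset.sum_const, nsmul_eq_mul, mul_one, mul_sub,
      inv_mul_cancel₀ hcard, hw]
    ring

end BestOfN

/-! ### Averaging over prompts, and transfer to the labelled training data. -/

namespace BestOfN

section Expect

variable {α : Type*}

theorem summable_mul_of_abs_le (p : PMF α) {f : α → ℝ} {C : ℝ} (hf : ∀ a, |f a| ≤ C) :
    Summable fun a => (p a).toReal * f a := by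
  have hp : Summable fun a => (p a).toReal := ENNReal.summable_toReal p.tsum_coe_ne_top
  refine Summable.of_norm_bounded (hp.mul_right C) fun a => ?_
  rw [norm_mul, Real.norm_of_nonneg ENNReal.toReal_nonneg]
  exact mul_le_mul_of_nonneg_left (hf a) ENNReal.toReal_nonneg

theorem expect_eq_toReal (p : PMF α) {f : α → ℝ} (hf : ∀ a, 0 ≤ f a) :
    expect p f = (∑' a, p a * ENNReal.ofReal (f a)).toReal := by
  rw [ENNReal.tsum_toReal_eq fun a => ENNReal.mul_ne_top (p.apply_ne_top a) ENNReal.ofReal_ne_top]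
  simp_rw [ENNReal.toReal_mul, ENNReal.toReal_ofReal (hf _)]
  rfl

/-- Only the prompt-average of the misjudged mass is controlled, which is why the pointwise bound
has to be affine. -/
theorem one_sub_affine_le_expect (p : PMF α) {f g : α → ℝ} {A B C D : ℝ}
    (hf : ∀ a, |f a| ≤ C) (hg : ∀ a, |g a| ≤ D) (h : ∀ a, 1 - (A + B * f a) ≤ g a) :
    1 - (A + B * expect p f) ≤ expect p g := by
  have hp : Summable fun a => (p a).toReal := ENNReal.summable_toReal p.tsum_coe_ne_top
  have h1 : ∑' a, (p a).toReal = 1 := by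
    rw [← ENNReal.tsum_toReal_eq p.apply_ne_top, p.tsum_coe, ENNReal.toReal_one]
  have hfs := summable_mul_of_abs_le p hf
  have h2 : 1 - (A + B * expect p f) =
      ∑' a, ((p a).toReal * (1 - A) - B * ((p a).toReal * f a)) := by
    rw [(hp.mul_right _).tsum_sub (hfs.mul_left B), tsum_mul_right, tsum_mul_left, h1]
    simp only [expect]
    ring
  rw [h2]
  refine Summable.tsum_le_tsum (fun a => ?_) ((hp.mul_right _).sub (hfs.mul_left B))
    (summable_mul_of_abs_le p hg)
  have := mul_le_mul_of_nonneg_left (h a) (ENNReal.toReal_nonneg (a := p a))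
  linarith

theorem ind_nonneg (P : Prop) : 0 ≤ ind P := by
  unfold ind
  split_ifs <;> simp

theorem ind_le_one (P : Prop) : ind P ≤ 1 := by
  unfold ind
  split_ifs <;> simp

theorem expect_nonneg (p : PMF α) {f : α → ℝ} (hf : ∀ a, 0 ≤ f a) : 0 ≤ expect p f :=
  tsum_nonneg fun a => mul_nonneg ENNReal.toReal_nonneg (hf a)

theorem expect_le_one [Fintype α] (p : PMF α) {f : α → ℝ} (hf : ∀ a, f a ≤ 1) :
    expect p f ≤ 1 := by
  rw [expect_eq_sum, ← sum_toReal p]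
  exact Finset.sum_le_sum fun a _ => mul_le_of_le_one_right ENNReal.toReal_nonneg (hf a)

end Expect

variable {T : ℕ}

theorem promptResponse_apply (PX : PMF Prompt) (π₀ : Prompt → PMF (Response T)) (x : Prompt)
    (y : Response T) : promptResponse PX π₀ (x, y) = PX x * π₀ x y := by
  classical
  rw [promptResponse, PMF.bind_apply, tsum_eq_single x]
  · rw [PMF.map_apply, tsum_eq_single y]
    · rw [if_pos rfl]
    · intro y' hy'
      rw [if_neg]
      simpa using hy'.symm
  · intro x' hx'
    rw [PMF.map_apply, ENNReal.tsum_eq_zero.2, mul_zero]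
    intro y'
    rw [if_neg]
    simp [hx'.symm]

theorem misjudged_nonneg (π₀ : Prompt → PMF (Response T)) (rstar ρ : Reward T) (x : Prompt) :
    0 ≤ misjudged π₀ rstar ρ x := expect_nonneg _ fun _ => ind_nonneg _

theorem classError_eq_expect (PX : PMF Prompt) (π₀ : Prompt → PMF (Response T))
    (rstar ρ : Reward T) : classError PX π₀ rstar ρ = expect PX (misjudged π₀ rstar ρ) := by
  rw [classError, expect_eq_toReal _ fun _ => ind_nonneg _,
    expect_eq_toReal _ (misjudged_nonneg π₀ rstar ρ), ENNReal.tsum_prod']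
  congr 1
  refine tsum_congr fun x => ?_
  simp_rw [promptResponse_apply, mul_assoc]
  rw [ENNReal.tsum_mul_left, misjudged, expect_eq_toReal _ fun _ => ind_nonneg _,
    ENNReal.ofReal_toReal]
  rw [tsum_fintype]
  exact (ENNReal.sum_lt_top.2 fun y _ => ENNReal.mul_lt_top ((π₀ x).apply_lt_top y)
    ENNReal.ofReal_lt_top).ne

theorem classError_eq_errorProb (PX : PMF Prompt) (π₀ : Prompt → PMF (Response T))
    (rstar ρ : Reward T) :
    classError PX π₀ rstar ρ = (errorProb (promptResponse PX π₀) rstar ρ).toReal := by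
  rw [classError, expect_eq_toReal _ fun _ => ind_nonneg _, errorProb]
  congr! 4 with z
  by_cases h : ρ z = rstar z <;> simp [zeroOne, ind, h, Ne.symm]

theorem one_sub_affine_le_expectedReward {PX : PMF Prompt} {π₀ : Prompt → PMF (Response T)}
    {rstar ρ : Reward T} {M : ℕ} {x A B : ℝ} (hcov : ∀ z, 1 - x ≤ coverage π₀ rstar z)
    (h : ∀ a u b : ℝ, 0 ≤ a → 0 ≤ u → 0 ≤ b → a + u ≤ x → a + u + b ≤ 1 →
        failureProb M a u b ≤ A + B * (a + b)) :
    1 - (A + B * classError PX π₀ rstar ρ) ≤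
      expectedReward PX (bonPolicy π₀ ρ (M + 1)) rstar := by
  rw [classError_eq_expect]
  refine one_sub_affine_le_expect (C := 1) (D := 1) PX (fun z => ?_) (fun z => ?_) fun z => ?_
  · rw [abs_of_nonneg (misjudged_nonneg π₀ rstar ρ z)]
    exact expect_le_one _ fun _ => ind_le_one _
  · rw [abs_of_nonneg (expect_nonneg _ fun _ => ind_nonneg _)]
    exact expect_le_one _ fun _ => ind_le_one _
  · obtain ⟨a, u, b, ha, hu, hb, hau, h1, hm, hr⟩ := exists_failureProb π₀ rstar ρ M z
    rw [hr, hm]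
    linarith [h a u b ha hu hb (by linarith [hcov z]) h1]

/-- Best-of-`(M + 1)` with a reward model of small classification error. -/
theorem le_expectedReward_of_classError_le {PX : PMF Prompt} {π₀ : Prompt → PMF (Response T)}
    {rstar ρ : Reward T} {M : ℕ} {x s c : ℝ} (hx : 0 < x) (hx1 : x < 1) (hc : c = -Real.log x)
    (hcov : ∀ z, 1 - x ≤ coverage π₀ rstar z) (hs : x ^ (M + 1) ≤ s) (hs' : s ≤ x ^ M)
    (hρ : 1 ≤ M → classError PX π₀ rstar ρ ≤ c * s + 25 / 4 * (c * s) ^ 2) :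
    1 - s * (1 - Real.log s) ≤ expectedReward PX (bonPolicy π₀ ρ (M + 1)) rstar := by
  -- A single draw ignores the reward model: it fails with probability at most `x ≤ s ≤ s * (1 - log
  -- s)`, since `s ≤ 1`.
  rcases Nat.eq_zero_or_pos M with rfl | hM
  · have h := one_sub_affine_le_expectedReward (PX := PX) (ρ := ρ) (M := 0) (A := x) (B := 0) hcov
      (fun a u b _ _ _ hau _ => by simp [failureProb]; linarith)
    have hs1 : x ≤ s := by simpa using hs
    have hlog := Real.log_nonpos (hx.le.trans hs1) (by simpa using hs')
    nlinarith
  · obtain ⟨A, B, hB, hf, h⟩ := exists_affine_bound hM hx hx1 hc hs hs'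
    have h1 := one_sub_affine_le_expectedReward (PX := PX) (ρ := ρ) hcov hf
    have h2 := mul_le_mul_of_nonneg_left (hρ hM) hB
    linarith

section Training

variable {PX : PMF Prompt} {π₀ : Prompt → PMF (Response T)} {rstar : Reward T}

theorem trainError_labelled {n : ℕ} (ρ : Reward T) (v : Fin n → Prompt × Response T) :
    (trainError (fun i => (v i, rstar (v i))) ρ : ℝ) = ∑ i, zeroOne (ρ (v i)) (rstar (v i)) := by
  simp [trainError, zeroOne, Finset.sum_ite]

/-- Attaching the true labels is injective on samples, so the unlabelled mass embeds into the
labelled one. The inequality in this direction is all that is needed. -/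
theorem tsum_labelled_le (n : ℕ) (S : Set (Fin n → (Prompt × Response T) × Bool)) :
    ∑' v, {v : Fin n → Prompt × Response T | (fun i => (v i, rstar (v i))) ∈ S}.indicator
        (fun v => ∏ i, promptResponse PX π₀ (v i)) v ≤
      (iid (exampleLaw PX π₀ rstar) n).toOuterMeasure S := by
  classical
  have hg : Function.Injective fun z : Prompt × Response T => (z, rstar z) :=
    fun a b h => congrArg Prod.fst h
  have hG : Function.Injective
      fun (v : Fin n → Prompt × Response T) (i : Fin n) => (v i, rstar (v i)) :=
    fun a b h => funext fun i => hg (congrFun h i)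
  rw [PMF.toOuterMeasure_apply]
  refine le_trans (ENNReal.tsum_le_tsum fun v => ?_)
    (ENNReal.tsum_comp_le_tsum_of_injective hG _)
  simp only [Set.indicator_apply, Set.mem_ofPred_eq]
  split_ifs
  · rw [iid_apply]
    refine Finset.prod_le_prod' fun i _ => ?_
    rw [exampleLaw, PMF.map_apply]
    refine le_trans (le_of_eq ?_) (ENNReal.le_tsum (v i))
    rw [if_pos rfl]
  · exact le_rfl

theorem le_toOuterMeasure_of_bad {n : ℕ} {δ : ℝ} (hδ : 0 ≤ δ)
    {S : Set (Fin n → (Prompt × Response T) × Bool)} {bad : Set (Fin n → Prompt × Response T)}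
    (hbad : ∑' v, bad.indicator (fun v => ∏ i, promptResponse PX π₀ (v i)) v ≤ ENNReal.ofReal δ)
    (h : ∀ v ∉ bad, (fun i => (v i, rstar (v i))) ∈ S) :
    ENNReal.ofReal (1 - δ) ≤ (iid (exampleLaw PX π₀ rstar) n).toOuterMeasure S := by
  refine le_trans ?_ (tsum_labelled_le n S)
  have h1 : ∑' v : Fin n → Prompt × Response T, ∏ i, promptResponse PX π₀ (v i) = 1 := by
    rw [← (iid (promptResponse PX π₀) n).tsum_coe]
    simp_rw [iid_apply]
  rw [ENNReal.ofReal_sub _ hδ, ENNReal.ofReal_one, tsub_le_iff_right, ← h1]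
  refine le_trans ?_ (add_le_add_right hbad _)
  rw [← ENNReal.tsum_add]
  refine ENNReal.tsum_le_tsum fun v => ?_
  by_cases hv : v ∈ bad
  · rw [Set.indicator_of_mem hv]
    exact le_add_self
  · rw [Set.indicator_of_mem (show v ∈ {v | (fun i => (v i, rstar (v i))) ∈ S} from h v hv)]
    exact le_self_add

end Training

end BestOfN

/-! ### Assembly. -/

theorem mainTheorem7 {T : ℕ}
    (r : BestOfN.Predictor → BestOfN.Reward T)
    (F : Set BestOfN.Predictor) (hF : F.Nonempty)
    (hVC : BestOfN.vcDim (BestOfN.rewardClass r F) ≠ ⊤)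
    (fstar : BestOfN.Predictor)
    (PX : PMF BestOfN.Prompt)
    (π₀ : BestOfN.Prompt → PMF (BestOfN.Response T))
    (α : ℝ) (hα0 : 0 < α) (hα1 : α < 1)
    (hcov : ∀ x, α ≤ BestOfN.coverage π₀ (r fstar) x)
    (n : ℕ) (hn : 0 < n)
    (δ : ℝ) (hδ0 : 0 < δ) (hδ1 : δ < 1)
    (κ : ℝ) (hκ : κ = BestOfN.kappa PX π₀ (r fstar) (BestOfN.rewardClass r F))
    (H : ℝ) (hH : H = BestOfN.rate n (BestOfN.rewardClass r F) δ)
    (N : ℕ) [NeZero N]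
    (hN : N = ⌈Real.logb (1 - α) ((-κ - H) / Real.log (1 - α))⌉₊) :
    ENNReal.ofReal (1 - δ) ≤
      (BestOfN.iid (BestOfN.exampleLaw PX π₀ (r fstar)) n).toOuterMeasure
        {D | ∀ rhat, BestOfN.IsERM (BestOfN.rewardClass r F) D rhat →
          1 - (κ + H) * (Real.logb (1 - α) ((-κ - H) / Real.log (1 - α))
                - 1 / Real.log (1 - α))
            ≤ BestOfN.expectedReward PX (BestOfN.bonPolicy π₀ rhat N) (r fstar)} := by
  obtain ⟨M, rfl⟩ := Nat.exists_eq_succ_of_ne_zero (NeZero.ne N)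
  obtain ⟨x, hx⟩ : ∃ x, x = 1 - α := ⟨_, rfl⟩
  obtain ⟨c, hc⟩ : ∃ c, c = -Real.log x := ⟨_, rfl⟩
  obtain ⟨s, hs⟩ : ∃ s, s = (κ + H) / c := ⟨_, rfl⟩
  have hx0 : 0 < x := by linarith
  have hx1 : x < 1 := by linarith
  have hlx : Real.log x = -c := by linarith
  have hc0 : 0 < c := by
    rw [hc]
    exact neg_pos.2 (Real.log_neg hx0 hx1)
  have hL : 0 < Real.log (1 / δ) := Real.log_pos ((one_lt_div hδ0).2 hδ1)
  have hR : (BestOfN.rewardClass r F).Nonempty := hF.image r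
  have hκ0 : 0 ≤ κ := by
    rw [hκ, BestOfN.kappa]
    refine Real.sInf_nonneg ?_
    rintro _ ⟨ρ, -, rfl⟩
    exact BestOfN.expect_nonneg _ fun _ => BestOfN.ind_nonneg _
  have hH0 : 0 < H := by
    rw [hH, BestOfN.rate]
    have : (0 : ℝ) < n := by exact_mod_cast hn
    positivity
  have hs0 : 0 < s := by rw [hs]; positivity
  have hcs : c * s = κ + H := by rw [hs]; field_simp
  have hlogb : Real.logb (1 - α) ((-κ - H) / Real.log (1 - α)) = -Real.log s / c := by
    rw [← hx, hlx, hs, Real.logb, hlx, ← neg_add', neg_div_neg_eq, div_neg, neg_div]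
  have hbound : (κ + H) * (Real.logb (1 - α) ((-κ - H) / Real.log (1 - α))
      - 1 / Real.log (1 - α)) = s * (1 - Real.log s) := by
    rw [hlogb, ← hcs, ← hx, hlx]
    field_simp
    ring
  -- Since `M + 1` is a natural-number ceiling, `M` lies strictly below its argument, even for `M =
  -- 0`. Together with `hN2` this gives `x ^ (M + 1) ≤ s ≤ x ^ M`.
  have hN1 : (M : ℝ) < -Real.log s / c := by
    rw [← hlogb, ← Nat.lt_ceil, ← hN]
    exact Nat.lt_succ_self M
  have hN2 : -Real.log s / c ≤ (M + 1 : ℕ) := by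
    rw [← hlogb]
    exact (Nat.le_ceil _).trans (by exact_mod_cast hN.ge)
  rw [lt_div_iff₀ hc0] at hN1
  rw [div_le_iff₀ hc0] at hN2
  have hs1 : x ^ (M + 1) ≤ s := by
    rw [← Real.log_le_log_iff (by positivity) hs0, Real.log_pow, hlx]
    linarith
  have hs2 : s ≤ x ^ M := by
    rw [← Real.log_le_log_iff hs0 (by positivity), Real.log_pow, hlx]
    linarith
  have hcov' : ∀ z, 1 - x ≤ BestOfN.coverage π₀ (r fstar) z := by
    rw [hx, sub_sub_cancel]
    exact hcov
  rw [hbound]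
  rcases Nat.eq_zero_or_pos M with hM | hM
  · refine BestOfN.le_toOuterMeasure_of_bad (bad := ∅) hδ0.le (by simp) fun v _ ρ _ => ?_
    exact BestOfN.le_expectedReward_of_classError_le hx0 hx1 hc hcov' hs1 hs2 fun h => by omega
  -- With at least two candidates `s ≤ x ^ M ≤ x`, hence `κ + H = c * s ≤ -x log x ≤ 1/e`.
  · have ht : κ + H ≤ 0.368 := by
      have h1 := mul_le_exp_neg_one hx0 hc
      have h2 : x ^ M ≤ x := pow_le_of_le_one hx0.le hx1.le hM.ne'
      nlinarith
    have hstat := tsum_erm_error_le (κ := κ) (H := H) (BestOfN.promptResponse PX π₀) (r fstar)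
      (BestOfN.rewardClass r F) hR hVC hn hL
      (by rw [hκ, BestOfN.kappa]; simp_rw [← BestOfN.classError_eq_errorProb]) hH ht
    rw [Real.log_div one_ne_zero hδ0.ne', Real.log_one, zero_sub, neg_neg, Real.exp_log hδ0]
      at hstat
    refine BestOfN.le_toOuterMeasure_of_bad hδ0.le hstat fun v hv ρ hρ => ?_
    refine BestOfN.le_expectedReward_of_classError_le hx0 hx1 hc hcov' hs1 hs2 fun _ => ?_
    rw [hcs]
    by_contra! hlt
    refine hv ⟨ρ, hρ.1, ?_, fun h' hh' => ?_⟩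
    · rwa [← BestOfN.classError_eq_errorProb]
    · rw [← BestOfN.trainError_labelled, ← BestOfN.trainError_labelled]
      exact_mod_cast hρ.2 h' hh'
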